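/- For $i\in\omega$ let $W_i$ be the $i$-th computably enumerable set and let $E_i$ be the equivalence relation on $\omega$ generated by $\{(x,y) : \langle x,y\rangle\in W_i\}$, so that $(E_i)_{i\in\omega}$ is the natural effective enumeration of all c.e. equivalence relations (ceers) on $\omega$. For equivalence relations $E,F$ on $\omega$ write $E\le F$ if there is a total computable function $f$ with $x\mathrel{E}y \iff f(x)\mathrel{F}f(y)$ for all $x,y$, and $E\equiv F$ if $E\le F$ and $F\le E$. For $S\subseteq\omega$ let $[S]=\{i : \exists j\in S\ (E_i\equiv E_j)\}$. Say that $S$ is proper on the infinite ceers if there are $i,j$ such that $E_i$ and $E_j$ both have infinitely many equivalence classes, $i\in[S]$ and $j\notin[S]$. Corollary. Let $S\subseteq\omega$ satisfy $S=[S]$. If $S$ is $\Pi^0_3$ and proper on the infinite ceers, then $[S]$ ($=S$) is $\Pi^0_3$-complete, that is, $[S]$ is $\Pi^0_3$ and every $\Pi^0_3$ set $B\subseteq\omega$ is one-one reducible (hence many-one reducible) to $[S]$. -/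

import Mathlib

namespace CeerIndex

/-- The `i`-th c.e. set `W_i`: the domain of the `i`-th partial computable function. -/
def W (i : ℕ) : Set ℕ :=
  {n | ((Denumerable.ofNat Nat.Partrec.Code i).eval n).Dom}

/-- The natural enumeration `(E_i)` of all ceers (c.e. equivalence relations on `ℕ`):
`E_i` is the equivalence relation generated by the pairs coded in the c.e. set `W_i`. -/
def ceer (i : ℕ) : Setoid ℕ :=
  Relation.EqvGen.setoid (fun x y => Nat.pair x y ∈ W i)

/-- Computable reduction `E ≤ F` between equivalence relations on `ℕ`. -/
def Reduces (E F : Setoid ℕ) : Prop :=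
  ∃ f : ℕ → ℕ, Computable f ∧ ∀ x y : ℕ, E x y ↔ F (f x) (f y)

/-- Computable equivalence `E ≡ F`. -/
def CompEquiv (E F : Setoid ℕ) : Prop :=
  Reduces E F ∧ Reduces F E

/-- The closure `[S] = {i | ∃ j ∈ S, E_i ≡ E_j}` of a set of indices of ceers. -/
def indexClosure (S : Set ℕ) : Set ℕ :=
  {i | ∃ j ∈ S, CompEquiv (ceer i) (ceer j)}

/-- `E` has infinitely many equivalence classes. -/
def InfinitelyManyClasses (E : Setoid ℕ) : Prop :=
  Infinite (Quotient E)

/-- `S` is proper on the infinite ceers. -/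
def ProperOnInfinite (S : Set ℕ) : Prop :=
  ∃ i j : ℕ, InfinitelyManyClasses (ceer i) ∧ InfinitelyManyClasses (ceer j) ∧
    i ∈ indexClosure S ∧ j ∉ indexClosure S

/-- `A` is `Π⁰₃`: membership is `∀ x, ∃ y, ∀ z, R n x y z` with `R` a computable relation. -/
def IsPi03 (A : Set ℕ) : Prop :=
  ∃ R : ℕ → ℕ → ℕ → ℕ → Prop,
    ComputablePred (fun p : ℕ × ℕ × ℕ × ℕ => R p.1 p.2.1 p.2.2.1 p.2.2.2) ∧
    ∀ n : ℕ, n ∈ A ↔ ∀ x, ∃ y, ∀ z, R n x y z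

/-- `A` is `Π⁰₃`-complete: it is `Π⁰₃`, and every `Π⁰₃` set reduces to it by an injective
computable function (one-one reducibility, which implies many-one reducibility). -/
def IsPi03Complete (A : Set ℕ) : Prop :=
  IsPi03 A ∧ ∀ B : Set ℕ, IsPi03 B →
    OneOneReducible (fun n : ℕ => n ∈ B) (fun n : ℕ => n ∈ A)

end CeerIndex

/-!
The proof shows that `S` is hard for `Π⁰₃` sets by playing the assumption that `S` is `Π⁰₃` against
itself. Let `ceer i` and `ceer j` be infinite with `i ∈ S` and `j ∉ S`, and let `B` be `Π⁰₃`. By the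
recursion theorem (`exists_code_built`) one may build, uniformly in `n`, a ceer with known index
`h n`. Both `n ∉ B` and `h n ∉ S` are `Σ⁰₃`, so each is the disjunction of a sequence of `Π⁰₂`
requirements. Interleave the two sequences, and suppose the constructed ceer can be made equivalent
to `ceer j` if the least true requirement is one for `n ∉ B`, and to `ceer i` if it is one for
`h n ∉ S`. The second case is impossible, since it gives `h n ∈ S`. Hence if some requirement is
true then `n ∉ B` and `h n ∉ S`; and if none is true then `n ∈ B` and `h n ∈ S`. Thus `h` reduces
`B` to `S` (`oneOneReducible_of_separating`), and it is one-one because `curry` is. Note that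
nothing is asked of the constructed ceer when no requirement is true.

The construction is a finite injury argument along a sequence `ι` whose limit inferior is the least
true requirement `e` (`leastActing_liminf`). At stage `u` the strategy `ι u` acts: it creates the
element `u`, collapses everything belonging to strategies of lower priority, and lets the elements of
its own run copy the current approximation to its target. It must leave alone the finitely many
elements protected by strategies of higher priority. These are absorbed by letting them represent
the first few classes of the target, as currently guessed; when the guess changes, the run is
abandoned. Since the target has infinitely many classes, the guess settles
(`Approximates.exists_settling`). From then on the map sending `m` to the `m`-th element of the run
is a reduction of the target to the constructed relation which meets every class
(`Settled.nth_reduces`, `Settled.exists_built_nth`), so that it can be inverted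
(`compEquiv_of_surjective_reduction`, `built_compEquiv`). The construction is kept primitive
recursive throughout, which makes its uniformity easy to check.
-/

namespace CeerIndex

/-! ### Computable approximations of ceers -/

/-- `τ u x` is the label of `x` at stage `u` of an approximation to the equivalence relation `T`:
labels only decrease, two points with the same label keep a common label at all later stages,
and two points are `T`-equivalent exactly when they have the same label at some stage. -/
structure Approximates (τ : ℕ → ℕ → ℕ) (T : Setoid ℕ) : Prop where
  le : ∀ u x, τ u x ≤ x
  comp : ∀ {u v}, u ≤ v → ∀ x, τ v (τ u x) = τ v x
  fresh : ∀ {u x}, u ≤ x → τ u x = x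
  rel : ∀ x y, T x y ↔ ∃ u, τ u x = τ u y

/-- The number of fixed points of `f` below `k`. -/
def fixedRank (f : ℕ → ℕ) (k : ℕ) : ℕ :=
  Nat.count (fun y => f y = y) k

namespace Approximates

variable {τ : ℕ → ℕ → ℕ} {T : Setoid ℕ}

theorem anti (h : Approximates τ T) {u v : ℕ} (huv : u ≤ v) (x : ℕ) : τ v x ≤ τ u x := by
  rw [← h.comp huv x]
  exact h.le _ _

theorem eq_of_le (h : Approximates τ T) {u v x y : ℕ} (huv : u ≤ v) (hxy : τ u x = τ u y) :
    τ v x = τ v y := by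
  rw [← h.comp huv x, hxy, h.comp huv y]

theorem idem (h : Approximates τ T) (u x : ℕ) : τ u (τ u x) = τ u x :=
  h.comp le_rfl x

theorem fixed_of_le (h : Approximates τ T) {u v x : ℕ} (huv : u ≤ v) (hx : τ v x = x) :
    τ u x = x :=
  le_antisymm (h.le _ _) (by simpa [hx] using h.anti huv x)

theorem exists_limit (h : Approximates τ T) (x : ℕ) : ∃ s, ∀ t ≥ s, τ t x = τ s x := by
  have hne : (Set.range fun s => τ s x).Nonempty := Set.range_nonempty _
  obtain ⟨s, hs⟩ := Nat.sInf_mem hne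
  refine ⟨s, fun t hst => le_antisymm (h.anti hst x) ?_⟩
  have := Nat.sInf_le (Set.mem_range_self (f := fun s => τ s x) t)
  simp only at hs this
  omega

theorem exists_limit_below (h : Approximates τ T) (κ : ℕ) :
    ∃ s, ∀ k < κ, ∀ t ≥ s, τ t k = τ s k := by
  choose s hs using h.exists_limit
  refine ⟨(Finset.range κ).sup s, fun k hk t ht => ?_⟩
  have : s k ≤ (Finset.range κ).sup s := Finset.le_sup (Finset.mem_range.2 hk)
  rw [hs k t (this.trans ht), hs k _ this]

/-- If `T` has infinitely many classes, then infinitely many points, namely the least elements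
of the classes, keep their label forever. -/
theorem infinite_fixed (h : Approximates τ T) (hT : InfinitelyManyClasses T) :
    (Set.ofPred fun x => ∀ u, τ u x = x).Infinite := by
  intro hfin
  have hF : Finite {x // ∀ u, τ u x = x} := hfin
  have hsurj : Function.Surjective
      (fun x : {x // ∀ u, τ u x = x} => (Quotient.mk T x.1)) := by
    intro q
    obtain ⟨x, rfl⟩ := Quotient.exists_rep q
    obtain ⟨s, hs⟩ := h.exists_limit x
    refine ⟨⟨τ s x, fun t => ?_⟩, Quotient.sound ((h.rel _ _).2 ⟨s, h.idem s x⟩)⟩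
    rcases le_total s t with hst | hst
    · rw [h.comp hst, hs t hst]
    · exact h.fixed_of_le hst (h.idem s x)
  have : Finite (Quotient T) := Finite.of_surjective _ hsurj
  exact not_finite_iff_infinite.2 hT this

open Classical in
/-- The first `p` classes of `T` are eventually known. From the first stage `v` on at which all
labels up to the `p`-th permanent fixed point are final, the predicate "fewer than `p` fixed points
lie below" and the fixed points satisfying it do not change, and the stages `s ≥ v` can be
recognised by comparing the labels at `s` with those at any later stage. -/
theorem exists_settling (h : Approximates τ T) (hT : InfinitelyManyClasses T) (p : ℕ) :
    ∃ v, ∀ u ≥ v,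
      (∀ x, fixedRank (τ u) x < p ↔ Nat.count (fun y => ∀ t, τ t y = y) x < p) ∧
      (∀ x, Nat.count (fun y => ∀ t, τ t y = y) x < p →
        fixedRank (τ u) x = Nat.count (fun y => ∀ t, τ t y = y) x ∧
        (τ u x = x ↔ ∀ t, τ t x = x)) ∧
      ∀ s ≤ u, ((∀ k < u, fixedRank (τ u) k < p → τ s k = τ u k) ↔ v ≤ s) := by
  set F : ℕ → Prop := fun y => ∀ t, τ t y = y with hF
  have hinf : (Set.ofPred F).Infinite := h.infinite_fixed hT
  have hbound : ∀ k, Nat.count F k < p → k < Nat.nth F p := by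
    intro k hk
    by_contra hle
    have := Nat.count_monotone F (not_lt.1 hle)
    rw [Nat.count_nth_of_infinite hinf] at this
    omega
  have hex : ∃ s, ∀ k, Nat.count F k < p → ∀ t ≥ s, τ t k = τ s k := by
    obtain ⟨s, hs⟩ := h.exists_limit_below (Nat.nth F p)
    exact ⟨s, fun k hk => hs k (hbound k hk)⟩
  have hv := Nat.find_spec hex
  have hmin : ∀ s, (∀ k, Nat.count F k < p → ∀ t ≥ s, τ t k = τ s k) → Nat.find hex ≤ s :=
    fun s hs => Nat.find_min' hex hs
  generalize Nat.find hex = v at hv hmin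
  have hfix : ∀ u ≥ v, ∀ x, Nat.count F x < p → (τ u x = x ↔ F x) := by
    intro u hu x hx
    refine ⟨fun hxu t => ?_, fun hx => hx u⟩
    rcases le_total t u with htu | htu
    · exact h.fixed_of_le htu hxu
    · rw [hv x hx t (hu.trans htu), ← hv x hx u hu, hxu]
  have hrank : ∀ u ≥ v, ∀ x, Nat.count F x < p → fixedRank (τ u) x = Nat.count F x := by
    intro u hu x hx
    refine le_antisymm (Nat.count_mono_left fun k hk hku => ?_)
      (Nat.count_mono_left fun k _ hk => hk u)
    exact (hfix u hu k (lt_of_le_of_lt (Nat.count_monotone F hk.le) hx)).1 hku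
  have hiff : ∀ u ≥ v, ∀ x, fixedRank (τ u) x < p ↔ Nat.count F x < p := by
    intro u hu x
    refine ⟨fun hx => lt_of_le_of_lt (Nat.count_mono_left fun k _ hk => hk u) hx, fun hx => ?_⟩
    rw [hrank u hu x hx]
    exact hx
  refine ⟨v, fun u hu => ⟨hiff u hu, fun x hx => ⟨hrank u hu x hx, hfix u hu x hx⟩,
    fun s hsu => ⟨fun hs => hmin s fun k hk t ht => ?_, fun hs k _ hk => ?_⟩⟩⟩
  · have hsk : τ s k = τ u k := by
      rcases lt_or_ge k u with hku | hku
      · exact hs k hku ((hiff u hu k).2 hk)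
      · rw [h.fresh hku, h.fresh (hsu.trans hku)]
    rcases le_total t u with htu | htu
    · exact le_antisymm (h.anti ht k) (hsk ▸ h.anti htu k)
    · rw [hsk, hv k hk t (hu.trans htu), hv k hk u hu]
  · rw [hv k ((hiff u hu k).1 hk) s hs, hv k ((hiff u hu k).1 hk) u hu]

end Approximates

/-- Replace the larger of the labels `a` and `b` by the smaller one. -/
def mergeLabels (a b y : ℕ) : ℕ :=
  if y = max a b then min a b else y

/-- The approximation to `ceer k`: at stage `u = ⟨t, ⟨x, y⟩⟩` the labels of `x` and `y` are merged if
`⟨x, y⟩` is seen to enter `W k` within `t` steps. -/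
def ceerApprox (k : ℕ) : ℕ → ℕ → ℕ
  | 0, x => x
  | u + 1, x =>
    if (Nat.Partrec.Code.evaln u.unpair.1 (Denumerable.ofNat Nat.Partrec.Code k)
        u.unpair.2).isSome then
      mergeLabels (ceerApprox k u u.unpair.2.unpair.1) (ceerApprox k u u.unpair.2.unpair.2)
        (ceerApprox k u x)
    else ceerApprox k u x

theorem mem_W_iff (k v : ℕ) : v ∈ W k ↔
    ∃ t, (Nat.Partrec.Code.evaln t (Denumerable.ofNat Nat.Partrec.Code k) v).isSome := by
  simp only [W, Set.mem_ofPred_eq, Part.dom_iff_mem, Nat.Partrec.Code.evaln_complete,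
    Option.isSome_iff_exists, Option.mem_def]
  exact exists_comm

theorem ceerApprox_le (k u x : ℕ) : ceerApprox k u x ≤ x := by
  induction u generalizing x with
  | zero => simp [ceerApprox]
  | succ u ih =>
    have := ih x
    rw [ceerApprox]
    unfold mergeLabels
    split_ifs <;> omega

theorem ceerApprox_fresh (k : ℕ) {u x : ℕ} (h : u ≤ x) : ceerApprox k u x = x := by
  induction u generalizing x with
  | zero => simp [ceerApprox]
  | succ u ih =>
    have h1 := ceerApprox_le k u u.unpair.2.unpair.1
    have h2 := ceerApprox_le k u u.unpair.2.unpair.2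
    have h3 := Nat.unpair_left_le u.unpair.2
    have h4 := Nat.unpair_right_le u.unpair.2
    have h5 := Nat.unpair_right_le u
    have hx : ceerApprox k u x = x := ih (by omega)
    rw [ceerApprox, hx]
    unfold mergeLabels
    split_ifs <;> omega

theorem ceerApprox_idem (k u x : ℕ) :
    ceerApprox k u (ceerApprox k u x) = ceerApprox k u x := by
  induction u generalizing x with
  | zero => simp [ceerApprox]
  | succ u ih =>
    simp only [ceerApprox]
    split_ifs with hs
    · have h1 := ih u.unpair.2.unpair.1
      have h2 := ih u.unpair.2.unpair.2
      have h3 := ih x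
      generalize ceerApprox k u u.unpair.2.unpair.1 = a at *
      generalize ceerApprox k u u.unpair.2.unpair.2 = b at *
      generalize ceerApprox k u x = y at *
      unfold mergeLabels
      by_cases hy : y = max a b
      · have : ceerApprox k u (min a b) = min a b := by
          rcases min_choice a b with h | h <;> rw [h] <;> assumption
        rw [if_pos hy, this]
        split_ifs <;> rfl
      · rw [if_neg hy, h3, if_neg hy]
    · exact ih x

theorem ceerApprox_comp (k : ℕ) {u v : ℕ} (h : u ≤ v) (x : ℕ) :
    ceerApprox k v (ceerApprox k u x) = ceerApprox k v x := by
  induction v, h using Nat.le_induction with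
  | base => exact ceerApprox_idem k u x
  | succ v _ ih => simp only [ceerApprox, ih]

theorem ceerApprox_approximates (k : ℕ) : Approximates (ceerApprox k) (ceer k) where
  le := ceerApprox_le k
  comp := ceerApprox_comp k
  fresh := ceerApprox_fresh k
  rel x y := by
    constructor
    · intro h
      induction h with
      | rel x y hxy =>
        obtain ⟨t, ht⟩ := (mem_W_iff k _).1 hxy
        refine ⟨Nat.pair t (Nat.pair x y) + 1, ?_⟩
        simp only [ceerApprox, Nat.unpair_pair, ht, if_true]
        unfold mergeLabels
        split_ifs <;> omega
      | refl x => exact ⟨0, rfl⟩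
      | symm x y _ ih => exact ih.imp fun _ h => h.symm
      | trans x y z _ _ ih1 ih2 =>
        obtain ⟨u, hu⟩ := ih1
        obtain ⟨v, hv⟩ := ih2
        refine ⟨max u v, ?_⟩
        rw [← ceerApprox_comp k (le_max_left u v) x, hu, ceerApprox_comp k (le_max_left u v),
          ← ceerApprox_comp k (le_max_right u v) y, hv, ceerApprox_comp k (le_max_right u v)]
    · have key : ∀ u x, ceer k x (ceerApprox k u x) := by
        intro u
        induction u with
        | zero => exact fun x => (ceer k).refl x
        | succ u ih =>
          intro x
          rw [ceerApprox]
          split_ifs with hs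
          · have hW : ceer k u.unpair.2.unpair.1 u.unpair.2.unpair.2 :=
              Relation.EqvGen.rel _ _ ((mem_W_iff k _).2 ⟨_, by simpa using hs⟩)
            have hab := (ceer k).trans ((ceer k).symm (ih u.unpair.2.unpair.1))
              ((ceer k).trans hW (ih u.unpair.2.unpair.2))
            have hx := ih x
            generalize ceerApprox k u u.unpair.2.unpair.1 = a at *
            generalize ceerApprox k u u.unpair.2.unpair.2 = b at *
            generalize ceerApprox k u x = y at *
            unfold mergeLabels
            split_ifs with hy
            · refine (ceer k).trans hx ?_
              rcases le_total a b with h | h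
              · rw [hy, max_eq_right h, min_eq_left h]
                exact (ceer k).symm hab
              · rw [hy, max_eq_left h, min_eq_right h]
                exact hab
            · exact hx
          · exact ih x
      rintro ⟨u, hu⟩
      exact (ceer k).trans (key u x) (hu ▸ (ceer k).symm (key u y))

/-! ### A finite injury construction -/

section Construction

/-- The element `s` belongs to the current run of the strategy `i = ι u` acting at stage `u`: it
was created by `i`, no strategy of higher priority has acted since, and the approximation to the
first `p` classes of the target of `i` has not changed since. -/
def InRun (ι : ℕ → ℕ) (τ : ℕ → ℕ → ℕ → ℕ) (u p s : ℕ) : Prop :=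
  0 < s ∧ ι s = ι u ∧ (∀ w < u + 1, s ≤ w → ι u ≤ ι w) ∧
    ∀ k < u, fixedRank (τ (ι u) u) k < p → τ (ι u) s k = τ (ι u) u k

instance (ι : ℕ → ℕ) (τ : ℕ → ℕ → ℕ → ℕ) (u p : ℕ) : DecidablePred (InRun ι τ u p) := by
  unfold InRun
  infer_instance

/-- The `x`-th element of the current run at stage `u` (and `0` if there is none up to `u`). -/
def runElement (ι : ℕ → ℕ) (τ : ℕ → ℕ → ℕ → ℕ) (u p x : ℕ) : ℕ :=
  ((List.range (u + 1)).filter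
    fun s => InRun ι τ u p s ∧ Nat.count (InRun ι τ u p) s = x).headI

/-- The map on elements applied at stage `u`, where `J` lists the elements protected by strategies
of higher priority than the acting strategy `i`. Protected elements and elements not yet
created stay fixed. The `m`-th element of the run of `i` stands for the point `m` of the target of
`i`; it is sent to the element standing for the current label of `m`, where the first `J.length`
labels are represented by the elements of `J`. All other elements are sent to `0`. -/
def collapse (ι : ℕ → ℕ) (τ : ℕ → ℕ → ℕ → ℕ) (u : ℕ) (J : List ℕ) (b : ℕ) : ℕ :=
  if b ∈ J ∨ u < b then b
  else if InRun ι τ u J.length b then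
    if fixedRank (τ (ι u) u) (τ (ι u) u (Nat.count (InRun ι τ u J.length) b)) < J.length then
      J.getD (fixedRank (τ (ι u) u) (τ (ι u) u (Nat.count (InRun ι τ u J.length) b))) 0
    else runElement ι τ u J.length (τ (ι u) u (Nat.count (InRun ι τ u J.length) b))
  else 0

/-- The members of `L` that are `0` or belong to a strategy of higher priority than the one
acting at stage `u`. -/
def senior (ι : ℕ → ℕ) (u : ℕ) (L : List ℕ) : List ℕ :=
  L.filter fun b => b = 0 ∨ ι b < ι u

/-- The elements created before stage `u` that have not been collapsed so far. -/
def alive (ι : ℕ → ℕ) (τ : ℕ → ℕ → ℕ → ℕ) : ℕ → List ℕ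
  | 0 => []
  | u + 1 => (alive ι τ u ++ [u]).filter
      fun b => collapse ι τ u (senior ι u (alive ι τ u ++ [u])) b = b

/-- The elements protected against the strategy acting at stage `u`. -/
def guarded (ι : ℕ → ℕ) (τ : ℕ → ℕ → ℕ → ℕ) (u : ℕ) : List ℕ :=
  senior ι u (alive ι τ u ++ [u])

/-- The label of `z` at stage `u`. -/
def label (ι : ℕ → ℕ) (τ : ℕ → ℕ → ℕ → ℕ) : ℕ → ℕ → ℕ
  | 0, z => z
  | u + 1, z => collapse ι τ u (guarded ι τ u) (label ι τ u z)

variable {ι : ℕ → ℕ} {τ : ℕ → ℕ → ℕ → ℕ}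

theorem runElement_le (u p x : ℕ) : runElement ι τ u p x ≤ u := by
  unfold runElement
  rcases hl : (List.range (u + 1)).filter
    fun s => InRun ι τ u p s ∧ Nat.count (InRun ι τ u p) s = x with _ | ⟨a, l⟩
  · exact Nat.zero_le _
  · have : a ∈ (List.range (u + 1)).filter
        fun s => InRun ι τ u p s ∧ Nat.count (InRun ι τ u p) s = x := hl ▸ List.mem_cons_self
    have := (List.mem_filter.1 this).1
    simp only [List.headI_cons]
    simpa [Nat.lt_succ_iff] using this

theorem mem_alive_lt {u b : ℕ} (h : b ∈ alive ι τ u) : b < u := by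
  induction u with
  | zero => simp [alive] at h
  | succ u ih =>
    have h1 := (List.mem_filter.1 h).1
    rcases List.mem_append.1 h1 with h1 | h1
    · exact (ih h1).trans u.lt_succ_self
    · simp at h1
      omega

theorem nodup_alive (u : ℕ) : (alive ι τ u).Nodup := by
  induction u with
  | zero => simp [alive]
  | succ u ih =>
    refine List.Nodup.filter _ (List.Nodup.append ih (List.nodup_singleton u) ?_)
    rw [List.disjoint_singleton]
    exact fun h => lt_irrefl _ (mem_alive_lt h)

theorem mem_guarded {u b : ℕ} :
    b ∈ guarded ι τ u ↔ (b ∈ alive ι τ u ∨ b = u) ∧ (b = 0 ∨ ι b < ι u) := by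
  simp [guarded, senior, or_and_right]

theorem mem_guarded_le {u b : ℕ} (h : b ∈ guarded ι τ u) : b ≤ u := by
  rcases (mem_guarded.1 h).1 with h | h
  · exact (mem_alive_lt h).le
  · exact h.le

theorem mem_alive_succ {u b : ℕ} : b ∈ alive ι τ (u + 1) ↔
    (b ∈ alive ι τ u ∨ b = u) ∧ collapse ι τ u (guarded ι τ u) b = b := by
  simp [alive, guarded, or_and_right]

theorem collapse_of_mem {u b : ℕ} {J : List ℕ} (h : b ∈ J) : collapse ι τ u J b = b :=
  if_pos (Or.inl h)

theorem collapse_of_lt {u b : ℕ} {J : List ℕ} (h : u < b) : collapse ι τ u J b = b :=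
  if_pos (Or.inr h)

theorem zero_mem_alive (u : ℕ) : 0 ∈ alive ι τ (u + 1) := by
  induction u with
  | zero =>
    exact mem_alive_succ.2 ⟨Or.inr rfl, collapse_of_mem (mem_guarded.2 ⟨Or.inr rfl, Or.inl rfl⟩)⟩
  | succ u ih =>
    exact mem_alive_succ.2 ⟨Or.inl ih, collapse_of_mem (mem_guarded.2 ⟨Or.inl ih, Or.inl rfl⟩)⟩

theorem zero_mem_guarded (u : ℕ) : 0 ∈ guarded ι τ u := by
  cases u with
  | zero => exact mem_guarded.2 ⟨Or.inr rfl, Or.inl rfl⟩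
  | succ u => exact mem_guarded.2 ⟨Or.inl (zero_mem_alive u), Or.inl rfl⟩

theorem collapse_guarded_le (u b : ℕ) : collapse ι τ u (guarded ι τ u) b ≤ max b u := by
  unfold collapse
  split_ifs with h1 h2 h3
  · exact le_max_left _ _
  · rw [List.getD_eq_getElem _ _ h3]
    exact (mem_guarded_le (List.getElem_mem h3)).trans (le_max_right _ _)
  · exact (runElement_le _ _ _).trans (le_max_right _ _)
  · exact Nat.zero_le _

theorem label_fresh {u z : ℕ} (h : u ≤ z) : label ι τ u z = z := by
  induction u with
  | zero => rfl
  | succ u ih => rw [label, ih (by omega), collapse_of_lt (by omega)]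

theorem label_le (u z : ℕ) : label ι τ u z ≤ max z u := by
  induction u with
  | zero => simp [label]
  | succ u ih =>
    have := collapse_guarded_le (ι := ι) (τ := τ) u (label ι τ u z)
    rw [label]
    omega

theorem label_eq_of_le {u v x y : ℕ} (h : u ≤ v) (hxy : label ι τ u x = label ι τ u y) :
    label ι τ v x = label ι τ v y := by
  induction v, h using Nat.le_induction with
  | base => exact hxy
  | succ v _ ih => rw [label, label, ih]

variable (ι τ) in
/-- The equivalence relation built by the construction: two elements are equivalent if they have
the same label at some stage. -/
def built : Setoid ℕ where
  r x y := ∃ u, label ι τ u x = label ι τ u y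
  iseqv := {
    refl := fun _ => ⟨0, rfl⟩
    symm := fun ⟨u, hu⟩ => ⟨u, hu.symm⟩
    trans := fun ⟨u, hu⟩ ⟨v, hv⟩ => ⟨max u v,
      (label_eq_of_le (le_max_left u v) hu).trans (label_eq_of_le (le_max_right u v) hv)⟩ }

theorem built_iff {x y : ℕ} : built ι τ x y ↔ ∃ u, label ι τ u x = label ι τ u y :=
  Iff.rfl

/-- The elements protected against a strategy `e` stay the same while no strategy of higher
priority acts. -/
theorem senior_alive_eq {e v u : ℕ} (hv : ∀ w ≥ v, e ≤ ι w) (hpos : 0 < v) (hu : v ≤ u) :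
    (alive ι τ u).filter (fun b => b = 0 ∨ ι b < e) =
      (alive ι τ v).filter (fun b => b = 0 ∨ ι b < e) := by
  induction u, hu using Nat.le_induction with
  | base => rfl
  | succ u hu ih =>
    have hown : ¬ (u = 0 ∨ ι u < e) := by
      have := hv u hu
      omega
    rw [← ih, alive, List.filter_filter, List.filter_append]
    have h2 : [u].filter (fun b => decide (b = 0 ∨ ι b < e) &&
        decide (collapse ι τ u (senior ι u (alive ι τ u ++ [u])) b = b)) = [] := by
      simp only [List.filter_eq_nil_iff, List.mem_singleton, Bool.and_eq_true, decide_eq_true_eq]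
      rintro b rfl hb
      exact hown hb.1
    rw [h2, List.append_nil]
    refine List.filter_congr fun b hb => ?_
    by_cases h : b = 0 ∨ ι b < e
    · have : b ∈ guarded ι τ u :=
        mem_guarded.2 ⟨Or.inl hb, h.imp id fun h => lt_of_lt_of_le h (hv u hu)⟩
      have := collapse_of_mem (ι := ι) (τ := τ) (u := u) this
      unfold guarded at this
      simp [h, this]
    · simp [h]

theorem guarded_eq {e v u : ℕ} (hv : ∀ w ≥ v, e ≤ ι w) (hpos : 0 < v) (hu : v ≤ u)
    (he : ι u = e) :
    guarded ι τ u = (alive ι τ v).filter (fun b => b = 0 ∨ ι b < e) := by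
  rw [← senior_alive_eq hv hpos hu, guarded, senior, List.filter_append, he]
  have h2 : [u].filter (fun b => decide (b = 0 ∨ ι b < e)) = [] := by
    simp only [List.filter_eq_nil_iff, List.mem_singleton, decide_eq_true_eq]
    rintro b rfl hb
    omega
  rw [h2, List.append_nil]

end Construction

theorem count_eq_of_forall_lt {P Q : ℕ → Prop} [DecidablePred P] [DecidablePred Q] {n : ℕ}
    (h : ∀ k < n, P k ↔ Q k) : Nat.count P n = Nat.count Q n :=
  le_antisymm (Nat.count_mono_left fun k hk => (h k hk).1)
    (Nat.count_mono_left fun k hk => (h k hk).2)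

/-- A computable reduction whose range meets every class can be inverted if the larger relation is
computably enumerable. -/
theorem compEquiv_of_surjective_reduction {E F : Setoid ℕ} {l : ℕ → ℕ → ℕ} {g : ℕ → ℕ}
    (hl : Computable₂ l) (hF : ∀ x y, F x y ↔ ∃ u, l u x = l u y) (hg : Computable g)
    (hred : ∀ x y, E x y ↔ F (g x) (g y)) (hsurj : ∀ z, ∃ m, F z (g m)) :
    CompEquiv F E := by
  have hex : ∀ z, ∃ n : ℕ, l n.unpair.1 z = l n.unpair.1 (g n.unpair.2) := by
    intro z
    obtain ⟨m, hm⟩ := hsurj z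
    obtain ⟨u, hu⟩ := (hF _ _).1 hm
    exact ⟨Nat.pair u m, by simpa using hu⟩
  have hu : Computable fun p : ℕ × ℕ => p.2.unpair.1 :=
    Computable.fst.comp (Computable.unpair.comp Computable.snd)
  have hm : Computable fun p : ℕ × ℕ => p.2.unpair.2 :=
    Computable.snd.comp (Computable.unpair.comp Computable.snd)
  have hdec : Computable₂ fun z n : ℕ =>
      decide (l n.unpair.1 z = l n.unpair.1 (g n.unpair.2)) :=
    (Primrec.eq (α := ℕ)).decide.to_comp.comp
      (hl.comp hu Computable.fst) (hl.comp hu (hg.comp hm))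
  have hfind : Computable fun z => Nat.find (hex z) := by
    refine (Partrec.rfind (p := fun z => fun n => Part.some
      (decide (l n.unpair.1 z = l n.unpair.1 (g n.unpair.2)))) hdec.partrec₂).of_eq fun z => ?_
    refine Part.eq_some_iff.2 (Nat.mem_rfind.2 ⟨?_, fun {m} hmlt => ?_⟩)
    · simpa using Nat.find_spec (hex z)
    · simpa using Nat.find_min (hex z) hmlt
  refine ⟨⟨fun z => (Nat.find (hex z)).unpair.2,
    Computable.snd.comp (Computable.unpair.comp hfind), fun x y => ?_⟩, g, hg, hred⟩
  have key : ∀ z, F z (g (Nat.find (hex z)).unpair.2) := fun z =>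
    (hF _ _).2 ⟨_, Nat.find_spec (hex z)⟩
  rw [hred]
  exact ⟨fun h => F.trans (F.symm (key x)) (F.trans h (key y)),
    fun h => F.trans (key x) (F.trans h (F.symm (key y)))⟩

/-! ### The outcome of the construction -/

section Outcome

variable {ι : ℕ → ℕ} {τ : ℕ → ℕ → ℕ → ℕ} {e V : ℕ} {J : List ℕ} {T : Setoid ℕ}

open Classical in
/-- The situation from stage `V` on, where `e` is the limit inferior of `ι`: no strategy of higher
priority than `e` acts any more, `J` lists the elements protected against `e`, the first
`J.length` classes of the target of `e` are known, and the run of `e` that starts at `V` is never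
given up. -/
structure Settled (ι : ℕ → ℕ) (τ : ℕ → ℕ → ℕ → ℕ) (e V : ℕ) (J : List ℕ) : Prop where
  pos : 0 < V
  prio : ∀ w ≥ V, e ≤ ι w
  inf : ∀ n, ∃ u ≥ n, ι u = e
  nodup : J.Nodup
  owner : ∀ b ∈ J, b = 0 ∨ ι b < e
  guard : ∀ u ≥ V, ι u = e → guarded ι τ u = J
  protect : ∀ u ≥ V, ∀ b ∈ J, b ∈ guarded ι τ u
  run : ∀ u ≥ V, ι u = e → ∀ s ≤ u, InRun ι τ u J.length s ↔ V ≤ s ∧ ι s = e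
  rank_lt : ∀ u ≥ V, ∀ x, fixedRank (τ e u) x < J.length ↔
    Nat.count (fun y => ∀ t, τ e t y = y) x < J.length
  rank_eq : ∀ u ≥ V, ∀ x, Nat.count (fun y => ∀ t, τ e t y = y) x < J.length →
    fixedRank (τ e u) x = Nat.count (fun y => ∀ t, τ e t y = y) x
  fixed_iff : ∀ u ≥ V, ∀ x, Nat.count (fun y => ∀ t, τ e t y = y) x < J.length →
    (τ e u x = x ↔ ∀ t, τ e t x = x)

theorem exists_settled (h : Approximates (τ e) T) (hT : InfinitelyManyClasses T)
    (hprio : ∃ v, ∀ w ≥ v, e ≤ ι w) (hinf : ∀ n, ∃ u ≥ n, ι u = e) :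
    ∃ V J, Settled ι τ e V J := by
  classical
  have hv0 := Nat.find_spec hprio
  have hmin : ∀ s, (∀ w ≥ s, e ≤ ι w) → Nat.find hprio ≤ s := fun s hs => Nat.find_min' hprio hs
  generalize Nat.find hprio = v0 at hv0 hmin
  set v := max 1 v0 with hvdef
  have hv : ∀ w ≥ v, e ≤ ι w := fun w hw => hv0 w ((le_max_right _ _).trans hw)
  have hvpos : 0 < v := lt_of_lt_of_le one_pos (le_max_left _ _)
  set J := (alive ι τ v).filter (fun b => b = 0 ∨ ι b < e) with hJ
  obtain ⟨v1, hv1⟩ := h.exists_settling hT J.length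
  have hvV : v ≤ max v v1 := le_max_left _ _
  have hv1V : v1 ≤ max v v1 := le_max_right _ _
  refine ⟨max v v1, J, ?_⟩
  have hown : ∀ b ∈ J, b = 0 ∨ ι b < e := fun b hb => by
    simpa using (List.mem_filter.1 hb).2
  refine
    { pos := hvpos.trans_le hvV
      prio := fun w hw => hv w (hvV.trans hw)
      inf := hinf
      nodup := (nodup_alive v).filter _
      owner := hown
      guard := fun u hu he => guarded_eq hv hvpos (hvV.trans hu) he
      protect := fun u hu b hb => ?_
      run := fun u hu he s hsu => ?_
      rank_lt := fun u hu => (hv1 u (hv1V.trans hu)).1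
      rank_eq := fun u hu x hx => ((hv1 u (hv1V.trans hu)).2.1 x hx).1
      fixed_iff := fun u hu x hx => ((hv1 u (hv1V.trans hu)).2.1 x hx).2 }
  · have hb' := hb
    rw [hJ, ← senior_alive_eq hv hvpos (hvV.trans hu)] at hb'
    exact mem_guarded.2 ⟨Or.inl (List.mem_filter.1 hb').1,
      (hown b hb).imp id fun h => h.trans_le (hv u (hvV.trans hu))⟩
  · have hsettle := (hv1 u (hv1V.trans hu)).2.2 s hsu
    unfold InRun
    rw [he, hsettle]
    constructor
    · rintro ⟨hs0, hse, hw, hs1⟩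
      refine ⟨max_le (max_le hs0 (hmin s fun w hsw => ?_)) hs1, hse⟩
      rcases lt_or_ge w (u + 1) with hwu | hwu
      · exact hw w hwu hsw
      · exact hv w (hvV.trans (hu.trans (by omega)))
    · rintro ⟨hs, hse⟩
      exact ⟨hvpos.trans_le (hvV.trans hs), hse, fun w _ hsw => hv w (hvV.trans (hs.trans hsw)),
        hv1V.trans hs⟩

open Classical in
/-- The element that stands for the class of the point `x`, where `x` is a fixed point of the
approximation to the target. -/
noncomputable def standIn (ι : ℕ → ℕ) (τ : ℕ → ℕ → ℕ → ℕ) (e V : ℕ) (J : List ℕ) (x : ℕ) : ℕ :=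
  if Nat.count (fun y => ∀ t, τ e t y = y) x < J.length then
    J.getD (Nat.count (fun y => ∀ t, τ e t y = y) x) 0
  else Nat.nth (fun s => V ≤ s ∧ ι s = e) x

namespace Settled

theorem infinite_run (H : Settled ι τ e V J) :
    (Set.ofPred fun s => V ≤ s ∧ ι s = e).Infinite := by
  rw [Set.infinite_iff_exists_gt]
  intro n
  obtain ⟨u, hu, he⟩ := H.inf (max V (n + 1))
  exact ⟨u, ⟨(le_max_left _ _).trans hu, he⟩, (le_max_right _ _).trans hu⟩

theorem nth_mem (H : Settled ι τ e V J) (m : ℕ) :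
    V ≤ Nat.nth (fun s => V ≤ s ∧ ι s = e) m ∧ ι (Nat.nth (fun s => V ≤ s ∧ ι s = e) m) = e :=
  Nat.nth_mem_of_infinite H.infinite_run m

theorem count_nth (H : Settled ι τ e V J) (m : ℕ) :
    Nat.count (fun s => V ≤ s ∧ ι s = e) (Nat.nth (fun s => V ≤ s ∧ ι s = e) m) = m :=
  Nat.count_nth_of_infinite H.infinite_run m

theorem not_mem_of_run (H : Settled ι τ e V J) {b : ℕ} (hb : V ≤ b ∧ ι b = e) : b ∉ J := by
  intro hJ
  have := H.pos
  rcases H.owner b hJ with h | h <;> omega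

theorem count_run (H : Settled ι τ e V J) {u b : ℕ} (hu : V ≤ u) (he : ι u = e) (hb : b ≤ u) :
    Nat.count (InRun ι τ u J.length) b = Nat.count (fun s => V ≤ s ∧ ι s = e) b :=
  count_eq_of_forall_lt fun k hk => H.run u hu he k (by omega)

theorem runElement_eq (H : Settled ι τ e V J) {u x : ℕ} (hu : V ≤ u) (he : ι u = e)
    (hx : Nat.nth (fun s => V ≤ s ∧ ι s = e) x ≤ u) :
    runElement ι τ u J.length x = Nat.nth (fun s => V ≤ s ∧ ι s = e) x := by
  have hmem : Nat.nth (fun s => V ≤ s ∧ ι s = e) x ∈ (List.range (u + 1)).filter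
      fun s => InRun ι τ u J.length s ∧ Nat.count (InRun ι τ u J.length) s = x := by
    rw [List.mem_filter, decide_eq_true_eq]
    refine ⟨List.mem_range.2 (by omega), (H.run u hu he _ hx).2 (H.nth_mem x), ?_⟩
    rw [H.count_run hu he hx, H.count_nth]
  unfold runElement
  rcases hl : (List.range (u + 1)).filter
    fun s => InRun ι τ u J.length s ∧ Nat.count (InRun ι τ u J.length) s = x with _ | ⟨a, l⟩
  · rw [hl] at hmem
    simp at hmem
  · have ha : a ∈ (List.range (u + 1)).filter
        fun s => InRun ι τ u J.length s ∧ Nat.count (InRun ι τ u J.length) s = x :=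
      hl ▸ List.mem_cons_self
    rw [List.mem_filter, decide_eq_true_eq, List.mem_range] at ha
    obtain ⟨hau, harun, hax⟩ := ha
    have hau' : a ≤ u := by omega
    rw [H.count_run hu he hau'] at hax
    rw [List.headI_cons, ← hax]
    exact (Nat.nth_count (p := fun s => V ≤ s ∧ ι s = e) ((H.run u hu he a hau').1 harun)).symm

/-- At a stage at which `e` acts, an element of its run goes to the element standing for the current
label of the corresponding point. -/
theorem collapse_run (H : Settled ι τ e V J) (h : Approximates (τ e) T) {u m : ℕ} (hu : V ≤ u)
    (he : ι u = e) (hm : Nat.nth (fun s => V ≤ s ∧ ι s = e) m ≤ u) :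
    collapse ι τ u (guarded ι τ u) (Nat.nth (fun s => V ≤ s ∧ ι s = e) m) =
      standIn ι τ e V J (τ e u m) := by
  have hle : Nat.nth (fun s => V ≤ s ∧ ι s = e) (τ e u m) ≤ u :=
    (Nat.nth_monotone H.infinite_run (h.le u m)).trans hm
  have hnot : ¬ (Nat.nth (fun s => V ≤ s ∧ ι s = e) m ∈ J ∨
      u < Nat.nth (fun s => V ≤ s ∧ ι s = e) m) := by
    rintro (hJ | hlt)
    · exact H.not_mem_of_run (H.nth_mem m) hJ
    · omega
  rw [H.guard u hu he, collapse, if_neg hnot, if_pos ((H.run u hu he _ hm).2 (H.nth_mem m)),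
    H.count_run hu he hm, H.count_nth, he, H.runElement_eq hu he hle, standIn]
  by_cases hr : fixedRank (τ e u) (τ e u m) < J.length
  · have hr' := (H.rank_lt u hu _).1 hr
    rw [if_pos hr, if_pos hr', H.rank_eq u hu _ hr']
  · have hr' := mt (H.rank_lt u hu _).2 hr
    rw [if_neg hr, if_neg hr']

theorem standIn_injective (H : Settled ι τ e V J) {u x y : ℕ} (hu : V ≤ u) (hx : τ e u x = x)
    (hy : τ e u y = y) (hxy : standIn ι τ e V J x = standIn ι τ e V J y) : x = y := by
  classical
  unfold standIn at hxy
  split_ifs at hxy with h1 h2 h2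
  · rw [List.getD_eq_getElem _ _ h1, List.getD_eq_getElem _ _ h2] at hxy
    exact Nat.count_injective ((H.fixed_iff u hu x h1).1 hx) ((H.fixed_iff u hu y h2).1 hy)
      ((List.Nodup.getElem_inj_iff H.nodup).1 hxy)
  · rw [List.getD_eq_getElem _ _ h1] at hxy
    exact absurd (hxy ▸ List.getElem_mem h1) (H.not_mem_of_run (H.nth_mem y))
  · rw [List.getD_eq_getElem _ _ h2] at hxy
    exact absurd (hxy ▸ List.getElem_mem h2) (H.not_mem_of_run (H.nth_mem x))
  · exact Nat.nth_injective H.infinite_run hxy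

/-- A run element whose point is so far a fixed point is alive. -/
theorem nth_mem_alive (H : Settled ι τ e V J) (h : Approximates (τ e) T) {w x : ℕ}
    (hxw : Nat.nth (fun s => V ≤ s ∧ ι s = e) x < w)
    (hfix : ∀ t < w, ι t = e → τ e t x = x)
    (hns : standIn ι τ e V J x = Nat.nth (fun s => V ≤ s ∧ ι s = e) x) :
    Nat.nth (fun s => V ≤ s ∧ ι s = e) x ∈ alive ι τ w := by
  have hV := H.nth_mem x
  induction w, (Nat.succ_le_iff.2 hxw) using Nat.le_induction with
  | base =>
    refine mem_alive_succ.2 ⟨Or.inr rfl, ?_⟩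
    rw [H.collapse_run h hV.1 hV.2 le_rfl, hfix _ (Nat.lt_succ_self _) hV.2, hns]
  | succ w hw ih =>
    have hw' : Nat.nth (fun s => V ≤ s ∧ ι s = e) x < w := hw
    have halive := ih hw' fun t ht => hfix t (by omega)
    refine mem_alive_succ.2 ⟨Or.inl halive, ?_⟩
    have hVw : V ≤ w := by omega
    rcases (H.prio w hVw).eq_or_lt with he | he
    · rw [H.collapse_run h hVw he.symm hw'.le, hfix w (by omega) he.symm, hns]
    · exact collapse_of_mem (mem_guarded.2 ⟨Or.inl halive, Or.inr (by omega)⟩)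

/-- Once the `m`-th run element exists, its label is the element standing for the label of `m` at the
last stage `t` at which `e` acted. -/
theorem label_nth (H : Settled ι τ e V J) (h : Approximates (τ e) T) {w m : ℕ}
    (hm : Nat.nth (fun s => V ≤ s ∧ ι s = e) m < w) :
    ∃ t < w, Nat.nth (fun s => V ≤ s ∧ ι s = e) m ≤ t ∧ (∀ t' < w, ι t' = e → t' ≤ t) ∧
      label ι τ w (Nat.nth (fun s => V ≤ s ∧ ι s = e) m) =
        standIn ι τ e V J (τ e t m) := by
  have hV := H.nth_mem m
  induction w, (Nat.succ_le_iff.2 hm) using Nat.le_induction with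
  | base =>
    refine ⟨_, Nat.lt_succ_self _, le_rfl, fun t' ht' _ => Nat.lt_succ_iff.1 ht', ?_⟩
    rw [label, label_fresh le_rfl, H.collapse_run h hV.1 hV.2 le_rfl]
  | succ w hw ih =>
    have hw' : Nat.nth (fun s => V ≤ s ∧ ι s = e) m < w := hw
    obtain ⟨t, htw, hmt, htmax, hlab⟩ := ih hw'
    have hVw : V ≤ w := by omega
    have hVt : V ≤ t := by omega
    have hidem := h.idem t m
    have hns : ∀ hc : ¬ standIn ι τ e V J (τ e t m) ∈ J,
        standIn ι τ e V J (τ e t m) = Nat.nth (fun s => V ≤ s ∧ ι s = e) (τ e t m) := by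
      intro hc
      unfold standIn at hc ⊢
      split_ifs at hc ⊢ with h1
      · rw [List.getD_eq_getElem _ _ h1] at hc
        exact absurd (List.getElem_mem h1) hc
      · rfl
    have hle : Nat.nth (fun s => V ≤ s ∧ ι s = e) (τ e t m) < w :=
      (Nat.nth_monotone H.infinite_run (h.le t m)).trans_lt hw'
    rcases (H.prio w hVw).eq_or_lt with he | he
    · refine ⟨w, Nat.lt_succ_self _, hw'.le, fun t' ht' _ => Nat.lt_succ_iff.1 ht', ?_⟩
      rw [label, hlab, ← h.comp htw.le m]
      unfold standIn
      by_cases hr : Nat.count (fun y => ∀ t, τ e t y = y) (τ e t m) < J.length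
      · -- The point `τ e t m` is one of the first `J.length` fixed points, which are final.
        have hfin := (H.fixed_iff t hVt _ hr).1 hidem
        rw [hfin w, if_pos hr]
        refine collapse_of_mem (H.protect w hVw _ ?_)
        rw [List.getD_eq_getElem _ _ hr]
        exact List.getElem_mem hr
      · rw [if_neg hr, H.collapse_run h hVw he.symm hle.le]
        rfl
    · refine ⟨t, by omega, hmt, fun t' ht' ht'e => ?_, ?_⟩
      · rcases Nat.lt_succ_iff_lt_or_eq.1 ht' with h1 | h1
        · exact htmax t' h1 ht'e
        · subst h1
          omega
      · rw [label, hlab]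
        by_cases hJ : standIn ι τ e V J (τ e t m) ∈ J
        · exact collapse_of_mem (H.protect w hVw _ hJ)
        · have hal := H.nth_mem_alive h hle
            (fun t' ht' ht'e => h.fixed_of_le (htmax t' ht' ht'e) hidem) (hns hJ)
          rw [hns hJ]
          have := H.nth_mem (τ e t m)
          exact collapse_of_mem (mem_guarded.2 ⟨Or.inl hal, Or.inr (by omega)⟩)

theorem label_nth_of_acting (H : Settled ι τ e V J) (h : Approximates (τ e) T) {u m : ℕ}
    (he : ι u = e) (hm : Nat.nth (fun s => V ≤ s ∧ ι s = e) m ≤ u) :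
    label ι τ (u + 1) (Nat.nth (fun s => V ≤ s ∧ ι s = e) m) =
      standIn ι τ e V J (τ e u m) := by
  obtain ⟨t, htu, -, hmax, hlab⟩ := H.label_nth h (Nat.lt_succ_iff.2 hm)
  have : t = u := le_antisymm (Nat.lt_succ_iff.1 htu) (hmax u (Nat.lt_succ_self u) he)
  rw [hlab, this]

theorem nth_reduces (H : Settled ι τ e V J) (h : Approximates (τ e) T) (x y : ℕ) :
    T x y ↔ built ι τ (Nat.nth (fun s => V ≤ s ∧ ι s = e) x)
      (Nat.nth (fun s => V ≤ s ∧ ι s = e) y) := by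
  rw [h.rel, built_iff]
  constructor
  · rintro ⟨u, hu⟩
    obtain ⟨w, hw, he⟩ := H.inf (max u (max (Nat.nth (fun s => V ≤ s ∧ ι s = e) x)
      (Nat.nth (fun s => V ≤ s ∧ ι s = e) y)))
    refine ⟨w + 1, ?_⟩
    rw [H.label_nth_of_acting h he (by omega), H.label_nth_of_acting h he (by omega),
      h.eq_of_le (by omega) hu]
  · rintro ⟨u, hu⟩
    obtain ⟨w, hw, he⟩ := H.inf (max u (max (Nat.nth (fun s => V ≤ s ∧ ι s = e) x)
      (Nat.nth (fun s => V ≤ s ∧ ι s = e) y)))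
    have hVx := H.nth_mem x
    have hlab := label_eq_of_le (show u ≤ w + 1 by omega) hu
    rw [H.label_nth_of_acting h he (by omega), H.label_nth_of_acting h he (by omega)] at hlab
    exact ⟨w, H.standIn_injective (by omega) (h.idem w x) (h.idem w y) hlab⟩

theorem label_mem_of_mem (H : Settled ι τ e V J) {u w z : ℕ} (hu : V ≤ u) (huw : u ≤ w)
    (hz : label ι τ u z ∈ J) : label ι τ w z = label ι τ u z := by
  induction w, huw using Nat.le_induction with
  | base => rfl
  | succ w hw ih => rw [label, ih, collapse_of_mem (H.protect w (hu.trans hw) _ hz)]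

theorem exists_built_nth (H : Settled ι τ e V J) (h : Approximates (τ e) T)
    (hT : InfinitelyManyClasses T) (z : ℕ) :
    ∃ m, built ι τ z (Nat.nth (fun s => V ≤ s ∧ ι s = e) m) := by
  classical
  -- A label in `J` is reached by the run element of the fixed point with the same rank.
  have hJ : ∀ u ≥ V, label ι τ u z ∈ J →
      ∃ m, built ι τ z (Nat.nth (fun s => V ≤ s ∧ ι s = e) m) := by
    intro u hu hz
    obtain ⟨q, hq, hqz⟩ := List.getElem_of_mem hz
    have hinf := h.infinite_fixed hT
    have hc := Nat.nth_mem_of_infinite hinf q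
    have hcq := Nat.count_nth_of_infinite hinf q
    generalize Nat.nth (fun x => ∀ u, τ e u x = x) q = c at hc hcq
    obtain ⟨w, hw, he⟩ := H.inf (max u (Nat.nth (fun s => V ≤ s ∧ ι s = e) c))
    refine ⟨c, w + 1, ?_⟩
    rw [H.label_mem_of_mem hu (by omega) hz, H.label_nth_of_acting h he (by omega), hc w, standIn]
    have hcq' : Nat.count (fun y => ∀ t, τ e t y = y) c = q := hcq
    rw [hcq', if_pos hq, List.getD_eq_getElem _ _ hq, hqz]
  obtain ⟨u, hu, he⟩ := H.inf (max V z)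
  have hVu : V ≤ u := (le_max_left _ _).trans hu
  have hzu : label ι τ u z ≤ u := (label_le u z).trans (by omega)
  by_cases hmem : label ι τ u z ∈ J
  · exact hJ u hVu hmem
  by_cases hrun : V ≤ label ι τ u z ∧ ι (label ι τ u z) = e
  · refine ⟨Nat.count (fun s => V ≤ s ∧ ι s = e) (label ι τ u z), u + 1, ?_⟩
    have hnth : Nat.nth (fun s => V ≤ s ∧ ι s = e)
        (Nat.count (fun s => V ≤ s ∧ ι s = e) (label ι τ u z)) = label ι τ u z :=
      Nat.nth_count hrun
    have hcol := H.collapse_run h (m := Nat.count (fun s => V ≤ s ∧ ι s = e) (label ι τ u z))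
      hVu he (by rwa [hnth])
    rw [H.label_nth_of_acting h he (by rwa [hnth]), ← hcol, hnth, label]
  · refine hJ (u + 1) (by omega) ?_
    have h0 : collapse ι τ u J (label ι τ u z) = 0 := by
      rw [collapse, if_neg (by simp only [hmem, false_or]; omega),
        if_neg (mt (H.run u hVu he _ hzu).1 hrun)]
    rw [label, H.guard u hVu he, h0, ← H.guard u hVu he]
    exact zero_mem_guarded u

end Settled

/-- If the limit inferior of `ι` is `e`, then the construction produces a relation that is
computably equivalent to the target of `e`. -/
theorem built_compEquiv (hι : Computable ι) (hl : Computable₂ (label ι τ))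
    (h : Approximates (τ e) T) (hT : InfinitelyManyClasses T)
    (hprio : ∃ v, ∀ w ≥ v, e ≤ ι w) (hinf : ∀ n, ∃ u ≥ n, ι u = e) :
    CompEquiv (built ι τ) T := by
  obtain ⟨V, J, H⟩ := exists_settled h hT hprio hinf
  refine compEquiv_of_surjective_reduction hl (fun x y => built_iff)
    (g := Nat.nth fun s => V ≤ s ∧ ι s = e) ?_ (H.nth_reduces h) (H.exists_built_nth h hT)
  have hP : Computable fun s => decide (V ≤ s ∧ ι s = e) :=
    (Primrec.and.to_comp.comp
      ((Primrec.nat_le.decide.to_comp).comp (Computable.const V) Computable.id)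
      ((Primrec.eq (α := ℕ)).decide.to_comp.comp hι (Computable.const e))).of_eq
      fun s => by simp
  have hcount : Computable fun n => Nat.count (fun s => V ≤ s ∧ ι s = e) n := by
    refine (Computable.nat_rec (f := fun n : ℕ => n) (g := fun _ => (0 : ℕ))
      (h := fun _ p => p.2 + cond (decide (V ≤ p.1 ∧ ι p.1 = e)) 1 0) Computable.id
      (Computable.const 0) ?_).of_eq fun n => ?_
    · exact Primrec.nat_add.to_comp.comp (Computable.snd.comp Computable.snd)
        (Computable.cond (hP.comp (Computable.fst.comp Computable.snd)) (Computable.const 1)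
          (Computable.const 0))
    · induction n with
      | zero => simp
      | succ n ih =>
        rw [Nat.count_succ, ← ih]
        by_cases hn : V ≤ n ∧ ι n = e <;> simp [hn]
  have hex : ∀ m, ∃ s, (V ≤ s ∧ ι s = e) ∧ Nat.count (fun s => V ≤ s ∧ ι s = e) s = m :=
    fun m => ⟨_, H.nth_mem m, H.count_nth m⟩
  have hdec : Computable₂ fun m s : ℕ =>
      decide ((V ≤ s ∧ ι s = e) ∧ Nat.count (fun s => V ≤ s ∧ ι s = e) s = m) :=
    (Primrec.and.to_comp.comp (hP.comp Computable.snd)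
      ((Primrec.eq (α := ℕ)).decide.to_comp.comp (hcount.comp Computable.snd)
        Computable.fst)).of_eq fun s => by simp
  refine (Partrec.rfind (p := fun m => fun s => Part.some
      (decide ((V ≤ s ∧ ι s = e) ∧ Nat.count (fun s => V ≤ s ∧ ι s = e) s = m)))
      hdec.partrec₂).of_eq fun m => ?_
  refine Part.eq_some_iff.2 (Nat.mem_rfind.2 ⟨?_, fun {n} hn => ?_⟩)
  · simpa using ⟨H.nth_mem m, H.count_nth m⟩
  · have : ¬ ((V ≤ n ∧ ι n = e) ∧ Nat.count (fun s => V ≤ s ∧ ι s = e) n = m) := by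
      rintro ⟨h1, h2⟩
      have := Nat.nth_count (p := fun s => V ≤ s ∧ ι s = e) h1
      rw [h2] at this
      omega
    simpa using this

end Outcome

/-! ### Primitive recursiveness of the construction -/

section Primrec

variable {α : Type*} [Primcodable α]

theorem primrecPred_forall_lt {f : α → ℕ} {R : α → ℕ → Prop} (hf : Primrec f)
    (hR : PrimrecPred fun p : α × ℕ => R p.1 p.2) : PrimrecPred fun a => ∀ x < f a, R a x := by
  have h : PrimrecRel fun (x : ℕ) (a : α) => R a x := hR.comp (Primrec.snd.pair Primrec.fst)
  exact (h.forall_mem_list.comp (Primrec.list_range.comp hf) Primrec.id).of_eq fun a => by simp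

theorem primrecPred_exists_lt {f : α → ℕ} {R : α → ℕ → Prop} (hf : Primrec f)
    (hR : PrimrecPred fun p : α × ℕ => R p.1 p.2) : PrimrecPred fun a => ∃ x < f a, R a x := by
  have h : PrimrecRel fun (x : ℕ) (a : α) => R a x := hR.comp (Primrec.snd.pair Primrec.fst)
  exact (h.exists_mem_list.comp (Primrec.list_range.comp hf) Primrec.id).of_eq fun a => by simp

theorem primrec_filter {f : α → List ℕ} {R : α → ℕ → Prop} [∀ a, DecidablePred (R a)]
    (hf : Primrec f) (hR : PrimrecPred fun p : α × ℕ => R p.1 p.2) :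
    Primrec fun a => (f a).filter (fun x => R a x) := by
  have h : PrimrecRel fun (x : ℕ) (a : α) => R a x := hR.comp (Primrec.snd.pair Primrec.fst)
  let _ : DecidableRel fun (x : ℕ) (a : α) => R a x := fun x a => inferInstance
  exact h.listFilter.comp hf Primrec.id

theorem primrec_count {f : α → ℕ} {R : α → ℕ → Prop} [∀ a, DecidablePred (R a)]
    (hf : Primrec f) (hR : PrimrecPred fun p : α × ℕ => R p.1 p.2) :
    Primrec fun a => Nat.count (R a) (f a) := by
  refine (Primrec.list_length.comp (primrec_filter (Primrec.list_range.comp hf) hR)).of_eq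
    fun a => ?_
  rw [Nat.count, List.countP_eq_length_filter]

theorem primrec_ceerApprox : Primrec fun p : ℕ × ℕ × ℕ => ceerApprox p.1 p.2.1 p.2.2 := by
  -- The table of the labels of all `x < u` at stage `u` is obtained by recursion on `u`.
  have htab : Primrec₂ fun k u : ℕ => (List.range u).map (ceerApprox k u) := by
    have hl : Primrec fun p : ℕ × ℕ × List ℕ => p.2.2 ++ [p.2.1] :=
      Primrec.list_concat.comp (Primrec.snd.comp Primrec.snd) (Primrec.fst.comp Primrec.snd)
    have hq : Primrec fun p : ℕ × ℕ × List ℕ => p.2.1.unpair :=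
      Primrec.unpair.comp (Primrec.fst.comp Primrec.snd)
    have hxy : Primrec fun p : ℕ × ℕ × List ℕ => p.2.1.unpair.2.unpair :=
      Primrec.unpair.comp (Primrec.snd.comp hq)
    have hA : Primrec fun p : ℕ × ℕ × List ℕ =>
        (p.2.2 ++ [p.2.1]).getD p.2.1.unpair.2.unpair.1 0 :=
      (Primrec.list_getD 0).comp hl (Primrec.fst.comp hxy)
    have hB : Primrec fun p : ℕ × ℕ × List ℕ =>
        (p.2.2 ++ [p.2.1]).getD p.2.1.unpair.2.unpair.2 0 :=
      (Primrec.list_getD 0).comp hl (Primrec.snd.comp hxy)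
    have hs : PrimrecPred fun p : ℕ × ℕ × List ℕ =>
        (Nat.Partrec.Code.evaln p.2.1.unpair.1 (Denumerable.ofNat Nat.Partrec.Code p.1)
          p.2.1.unpair.2).isSome = true :=
      Primrec.eq.comp (Primrec.option_isSome.comp (Nat.Partrec.Code.primrec_evaln.comp
        (((Primrec.fst.comp hq).pair ((Primrec.ofNat _).comp Primrec.fst)).pair
          (Primrec.snd.comp hq)))) (Primrec.const true)
    have hmerge : Primrec fun p : ℕ × ℕ × ℕ => mergeLabels p.1 p.2.1 p.2.2 := by
      have h1 : Primrec fun p : ℕ × ℕ × ℕ => p.1 := Primrec.fst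
      have h2 : Primrec fun p : ℕ × ℕ × ℕ => p.2.1 := Primrec.fst.comp Primrec.snd
      have h3 : Primrec fun p : ℕ × ℕ × ℕ => p.2.2 := Primrec.snd.comp Primrec.snd
      exact Primrec.ite (Primrec.eq.comp h3 (Primrec.nat_max.comp h1 h2))
        (Primrec.nat_min.comp h1 h2) h3
    have hstep : Primrec₂ fun (k : ℕ) (p : ℕ × List ℕ) => (p.2 ++ [p.1]).map fun y =>
        if (Nat.Partrec.Code.evaln p.1.unpair.1 (Denumerable.ofNat Nat.Partrec.Code k)
          p.1.unpair.2).isSome = true then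
          mergeLabels ((p.2 ++ [p.1]).getD p.1.unpair.2.unpair.1 0)
            ((p.2 ++ [p.1]).getD p.1.unpair.2.unpair.2 0) y
        else y := by
      exact Primrec.list_map hl (Primrec.ite (hs.comp Primrec.fst) (hmerge.comp
        ((hA.comp Primrec.fst).pair ((hB.comp Primrec.fst).pair Primrec.snd))) Primrec.snd)
    refine (Primrec.nat_rec (Primrec.const []) hstep).of_eq fun k u => ?_
    induction u with
    | zero => rfl
    | succ u ih =>
      simp only at ih ⊢
      have hcat : (List.range u).map (ceerApprox k u) ++ [u] =
          (List.range (u + 1)).map (ceerApprox k u) := by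
        rw [List.range_succ, List.map_append, List.map_singleton, ceerApprox_fresh k le_rfl]
      have hget : ∀ j ≤ u, ((List.range (u + 1)).map (ceerApprox k u)).getD j 0 =
          ceerApprox k u j := by
        intro j hj
        rw [List.getD_eq_getElem _ _ (by simpa using Nat.lt_succ_iff.2 hj)]
        simp
      have h1 : u.unpair.2.unpair.1 ≤ u :=
        (Nat.unpair_left_le _).trans (Nat.unpair_right_le _)
      have h2 : u.unpair.2.unpair.2 ≤ u :=
        (Nat.unpair_right_le _).trans (Nat.unpair_right_le _)
      rw [ih, hcat, hget _ h1, hget _ h2, List.map_map]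
      rfl
  have hx : Primrec fun p : ℕ × ℕ × ℕ => p.2.2 := Primrec.snd.comp Primrec.snd
  refine (Primrec.option_getD.comp (Primrec.list_getElem?.comp
    (htab.comp Primrec.fst (Primrec.fst.comp Primrec.snd)) hx) hx).of_eq fun p => ?_
  obtain ⟨k, u, x⟩ := p
  rcases lt_or_ge x u with h | h
  · simp [h]
  · simp [h, ceerApprox_fresh k h]

variable {ι : ℕ → ℕ → ℕ} {τ : ℕ → ℕ → ℕ → ℕ}

theorem primrec_fixedRank (hτ : Primrec fun p : ℕ × ℕ × ℕ => τ p.1 p.2.1 p.2.2) :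
    Primrec fun p : ℕ × ℕ × ℕ => fixedRank (τ p.1 p.2.1) p.2.2 :=
  primrec_count (R := fun (p : ℕ × ℕ × ℕ) y => τ p.1 p.2.1 y = y)
    (Primrec.snd.comp Primrec.snd)
    (Primrec.eq.comp (hτ.comp ((Primrec.fst.comp Primrec.fst).pair
      ((Primrec.fst.comp (Primrec.snd.comp Primrec.fst)).pair Primrec.snd))) Primrec.snd)

theorem primrec_inRun (hι : Primrec₂ ι) (hτ : Primrec fun p : ℕ × ℕ × ℕ => τ p.1 p.2.1 p.2.2) :
    PrimrecPred fun q : ℕ × ℕ × ℕ × ℕ => InRun (ι q.1) τ q.2.1 q.2.2.1 q.2.2.2 := by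
  have ha : Primrec fun q : ℕ × ℕ × ℕ × ℕ => q.1 := Primrec.fst
  have hu : Primrec fun q : ℕ × ℕ × ℕ × ℕ => q.2.1 := Primrec.fst.comp Primrec.snd
  have hp : Primrec fun q : ℕ × ℕ × ℕ × ℕ => q.2.2.1 :=
    Primrec.fst.comp (Primrec.snd.comp Primrec.snd)
  have hs : Primrec fun q : ℕ × ℕ × ℕ × ℕ => q.2.2.2 :=
    Primrec.snd.comp (Primrec.snd.comp Primrec.snd)
  have hi : Primrec fun q : ℕ × ℕ × ℕ × ℕ => ι q.1 q.2.1 := hι.comp ha hu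
  have f1 {β : Type} [Primcodable β] {f : ℕ × ℕ × ℕ × ℕ → β} (hf : Primrec f) :
      Primrec fun r : (ℕ × ℕ × ℕ × ℕ) × ℕ => f r.1 := hf.comp Primrec.fst
  refine (Primrec.nat_lt.comp (Primrec.const 0) hs).and
    ((Primrec.eq.comp (hι.comp ha hs) hi).and
      ((primrecPred_forall_lt (Primrec.succ.comp hu) ?_).and (primrecPred_forall_lt hu ?_)))
  · exact ((Primrec.nat_le.comp (f1 hs) Primrec.snd).not.or
      (Primrec.nat_le.comp (f1 hi) (hι.comp (f1 ha) Primrec.snd))).of_eq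
        fun r => by rw [imp_iff_not_or]
  · exact ((Primrec.nat_lt.comp ((primrec_fixedRank hτ).comp
      ((f1 hi).pair ((f1 hu).pair Primrec.snd))) (f1 hp)).not.or
      (Primrec.eq.comp (hτ.comp ((f1 hi).pair ((f1 hs).pair Primrec.snd)))
        (hτ.comp ((f1 hi).pair ((f1 hu).pair Primrec.snd))))).of_eq
        fun r => by rw [imp_iff_not_or]

theorem primrec_collapse (hι : Primrec₂ ι)
    (hτ : Primrec fun p : ℕ × ℕ × ℕ => τ p.1 p.2.1 p.2.2) :
    Primrec fun q : ℕ × ℕ × List ℕ × ℕ => collapse (ι q.1) τ q.2.1 q.2.2.1 q.2.2.2 := by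
  have ha : Primrec fun q : ℕ × ℕ × List ℕ × ℕ => q.1 := Primrec.fst
  have hu : Primrec fun q : ℕ × ℕ × List ℕ × ℕ => q.2.1 := Primrec.fst.comp Primrec.snd
  have hJ : Primrec fun q : ℕ × ℕ × List ℕ × ℕ => q.2.2.1 :=
    Primrec.fst.comp (Primrec.snd.comp Primrec.snd)
  have hb : Primrec fun q : ℕ × ℕ × List ℕ × ℕ => q.2.2.2 :=
    Primrec.snd.comp (Primrec.snd.comp Primrec.snd)
  have hp : Primrec fun q : ℕ × ℕ × List ℕ × ℕ => q.2.2.1.length := Primrec.list_length.comp hJ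
  have hi : Primrec fun q : ℕ × ℕ × List ℕ × ℕ => ι q.1 q.2.1 := hι.comp ha hu
  have hrun := primrec_inRun hι hτ
  have hcount : Primrec fun q : ℕ × ℕ × ℕ × ℕ =>
      Nat.count (InRun (ι q.1) τ q.2.1 q.2.2.1) q.2.2.2 :=
    primrec_count (R := fun (q : ℕ × ℕ × ℕ × ℕ) s => InRun (ι q.1) τ q.2.1 q.2.2.1 s)
      (Primrec.snd.comp (Primrec.snd.comp Primrec.snd))
      (hrun.comp ((Primrec.fst.comp Primrec.fst).pair
        ((Primrec.fst.comp (Primrec.snd.comp Primrec.fst)).pair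
          ((Primrec.fst.comp (Primrec.snd.comp (Primrec.snd.comp Primrec.fst))).pair
            Primrec.snd))))
  have helt : Primrec fun q : ℕ × ℕ × ℕ × ℕ =>
      runElement (ι q.1) τ q.2.1 q.2.2.1 q.2.2.2 := by
    have hr : Primrec fun r : (ℕ × ℕ × ℕ × ℕ) × ℕ => (r.1.1, r.1.2.1, r.1.2.2.1, r.2) :=
      (Primrec.fst.comp Primrec.fst).pair
        ((Primrec.fst.comp (Primrec.snd.comp Primrec.fst)).pair
          ((Primrec.fst.comp (Primrec.snd.comp (Primrec.snd.comp Primrec.fst))).pair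
            Primrec.snd))
    refine Primrec.list_headI.comp (primrec_filter
      (R := fun (q : ℕ × ℕ × ℕ × ℕ) s => InRun (ι q.1) τ q.2.1 q.2.2.1 s ∧
        Nat.count (InRun (ι q.1) τ q.2.1 q.2.2.1) s = q.2.2.2)
      (Primrec.list_range.comp (Primrec.succ.comp (Primrec.fst.comp Primrec.snd)))
      ((hrun.comp hr).and (Primrec.eq.comp (hcount.comp hr)
        (Primrec.snd.comp (Primrec.snd.comp (Primrec.snd.comp Primrec.fst))))))
  have hmem : PrimrecPred fun q : ℕ × ℕ × List ℕ × ℕ => q.2.2.2 ∈ q.2.2.1 :=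
    (Primrec.nat_lt.comp (Primrec.list_idxOf.comp hb hJ) hp).of_eq
      fun q => List.idxOf_lt_length_iff
  have hx : Primrec fun q : ℕ × ℕ × List ℕ × ℕ => τ (ι q.1 q.2.1) q.2.1
      (Nat.count (InRun (ι q.1) τ q.2.1 q.2.2.1.length) q.2.2.2) :=
    hτ.comp (hi.pair (hu.pair (hcount.comp (ha.pair (hu.pair (hp.pair hb))))))
  have hrank := (primrec_fixedRank hτ).comp (hi.pair (hu.pair hx))
  exact Primrec.ite (hmem.or (Primrec.nat_lt.comp hu hb)) hb
    (Primrec.ite (hrun.comp (ha.pair (hu.pair (hp.pair hb))))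
      (Primrec.ite (Primrec.nat_lt.comp hrank hp) ((Primrec.list_getD 0).comp hJ hrank)
        (helt.comp (ha.pair (hu.pair (hp.pair hx))))) (Primrec.const 0))

theorem primrec_senior (hι : Primrec₂ ι) :
    Primrec fun q : ℕ × ℕ × List ℕ => senior (ι q.1) q.2.1 q.2.2 :=
  primrec_filter (R := fun (q : ℕ × ℕ × List ℕ) b => b = 0 ∨ ι q.1 b < ι q.1 q.2.1)
    (Primrec.snd.comp Primrec.snd)
    ((Primrec.eq.comp Primrec.snd (Primrec.const 0)).or
      (Primrec.nat_lt.comp (hι.comp (Primrec.fst.comp Primrec.fst) Primrec.snd)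
        (hι.comp (Primrec.fst.comp Primrec.fst)
          (Primrec.fst.comp (Primrec.snd.comp Primrec.fst)))))

theorem primrec_alive (hι : Primrec₂ ι)
    (hτ : Primrec fun p : ℕ × ℕ × ℕ => τ p.1 p.2.1 p.2.2) :
    Primrec₂ fun a u : ℕ => alive (ι a) τ u := by
  have hl : Primrec fun p : ℕ × ℕ × List ℕ => p.2.2 ++ [p.2.1] :=
    Primrec.list_concat.comp (Primrec.snd.comp Primrec.snd) (Primrec.fst.comp Primrec.snd)
  have hu : Primrec fun p : ℕ × ℕ × List ℕ => p.2.1 := Primrec.fst.comp Primrec.snd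
  have hsen := (primrec_senior hι).comp (Primrec.fst.pair (hu.pair hl))
  have hstep : Primrec₂ fun (a : ℕ) (p : ℕ × List ℕ) => (p.2 ++ [p.1]).filter fun b =>
      collapse (ι a) τ p.1 (senior (ι a) p.1 (p.2 ++ [p.1])) b = b :=
    primrec_filter (α := ℕ × ℕ × List ℕ)
      (R := fun q b => collapse (ι q.1) τ q.2.1 (senior (ι q.1) q.2.1 (q.2.2 ++ [q.2.1])) b = b)
      hl (Primrec.eq.comp ((primrec_collapse hι hτ).comp ((Primrec.fst.comp Primrec.fst).pair
        ((hu.comp Primrec.fst).pair ((hsen.comp Primrec.fst).pair Primrec.snd)))) Primrec.snd)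
  refine (Primrec.nat_rec (Primrec.const []) hstep).of_eq fun a u => ?_
  induction u with
  | zero => rfl
  | succ u ih =>
    simp only at ih ⊢
    rw [ih, alive]

theorem primrec_label (hι : Primrec₂ ι)
    (hτ : Primrec fun p : ℕ × ℕ × ℕ => τ p.1 p.2.1 p.2.2) :
    Primrec fun p : ℕ × ℕ × ℕ => label (ι p.1) τ p.2.1 p.2.2 := by
  have hg : Primrec₂ fun a u : ℕ => guarded (ι a) τ u :=
    (primrec_senior hι).comp (Primrec.fst.pair (Primrec.snd.pair
      (Primrec.list_concat.comp (primrec_alive hι hτ) Primrec.snd)))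
  have hu : Primrec fun r : (ℕ × ℕ × ℕ) × ℕ × ℕ => r.2.1 := Primrec.fst.comp Primrec.snd
  have ha : Primrec fun r : (ℕ × ℕ × ℕ) × ℕ × ℕ => r.1.1 := Primrec.fst.comp Primrec.fst
  have hstep : Primrec₂ fun (p : ℕ × ℕ × ℕ) (r : ℕ × ℕ) =>
      collapse (ι p.1) τ r.1 (guarded (ι p.1) τ r.1) r.2 :=
    (primrec_collapse hι hτ).comp (ha.pair (hu.pair ((hg.comp ha hu).pair
      (Primrec.snd.comp Primrec.snd))))
  refine (Primrec.nat_rec' (Primrec.fst.comp Primrec.snd) (Primrec.snd.comp Primrec.snd)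
    hstep).of_eq fun p => ?_
  obtain ⟨a, u, z⟩ := p
  induction u with
  | zero => rfl
  | succ u ih =>
    simp only at ih ⊢
    rw [ih, label]

end Primrec

/-! ### Guessing the least true requirement -/

section Requirements

/-- By stage `s`, a witness below `s` has been found for each of the first `y + 1` instances of
requirement `i`. -/
def Verified (D : ℕ → ℕ → ℕ → Prop) (i y s : ℕ) : Prop :=
  y < s ∧ ∀ y' < y + 1, ∃ z < s, D i y' z

/-- Requirement `i` acts at stage `s` if some further instance of it becomes verified. -/
def Acts (D : ℕ → ℕ → ℕ → Prop) (i s : ℕ) : Prop :=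
  ∃ y < s + 1, Verified D i y (s + 1) ∧ ¬ Verified D i y s

open Classical in
/-- The least `i < s` that acts at stage `s`, or `s` if there is none. -/
noncomputable def leastActing (D : ℕ → ℕ → ℕ → Prop) (s : ℕ) : ℕ :=
  Nat.count (fun i => ∀ j < i + 1, ¬ Acts D j s) s

variable {D : ℕ → ℕ → ℕ → Prop}

theorem Verified.mono {i y s t : ℕ} (h : Verified D i y s) (hst : s ≤ t) : Verified D i y t :=
  ⟨h.1.trans_le hst, fun y' hy' =>
    let ⟨z, hz, hD⟩ := h.2 y' hy'
    ⟨z, hz.trans_le hst, hD⟩⟩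

theorem exists_acts {i : ℕ} (h : ∀ y, ∃ z, D i y z) (n : ℕ) : ∃ s ≥ n, Acts D i s := by
  classical
  have hex : ∃ s, Verified D i n s := by
    choose z hz using h
    refine ⟨max (n + 1) ((Finset.range (n + 1)).sup z + 1), by omega, fun y hy => ⟨z y, ?_, hz y⟩⟩
    have : z y ≤ (Finset.range (n + 1)).sup z := Finset.le_sup (Finset.mem_range.2 hy)
    omega
  have hspec := Nat.find_spec hex
  have hn := hspec.1
  have hmin := Nat.find_min hex (m := Nat.find hex - 1) (by omega)
  refine ⟨Nat.find hex - 1, by omega, n, by omega, ?_, hmin⟩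
  rwa [Nat.sub_add_cancel (by omega)]

theorem eventually_not_acts {i : ℕ} (h : ¬ ∀ y, ∃ z, D i y z) : ∃ v, ∀ s ≥ v, ¬ Acts D i s := by
  push Not at h
  obtain ⟨y0, hy0⟩ := h
  have hy : ∀ y, ∃ v, ∀ s ≥ v, Verified D i y (s + 1) → Verified D i y s := by
    intro y
    by_cases hex : ∃ v, Verified D i y v
    · exact hex.imp fun v hv s hs _ => hv.mono hs
    · exact ⟨0, fun s _ hs => absurd ⟨_, hs⟩ hex⟩
  choose v hv using hy
  refine ⟨(Finset.range y0).sup v, fun s hs ⟨y, _, h1, h2⟩ => ?_⟩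
  have hlt : y < y0 := by
    by_contra hle
    obtain ⟨z, _, hz⟩ := h1.2 y0 (by omega)
    exact hy0 z hz
  have : v y ≤ (Finset.range y0).sup v := Finset.le_sup (Finset.mem_range.2 hlt)
  exact h2 (hv y s (this.trans hs) h1)

theorem le_leastActing {e s : ℕ} (hes : e ≤ s) (h : ∀ j < e, ¬ Acts D j s) :
    e ≤ leastActing D s := by
  classical
  have : Nat.count (fun i => ∀ j < i + 1, ¬ Acts D j s) e = e :=
    Nat.count_iff_forall.2 fun i hi j hj => h j (by omega)
  exact this.symm.le.trans (Nat.count_monotone _ hes)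

theorem leastActing_le {e s : ℕ} (h : Acts D e s) : leastActing D s ≤ e := by
  classical
  rcases le_total s e with hse | hes
  · exact (Nat.count_le _).trans hse
  · obtain ⟨d, rfl⟩ := Nat.exists_eq_add_of_le hes
    unfold leastActing
    rw [Nat.count_add]
    have : Nat.count (fun k => ∀ j < e + k + 1, ¬ Acts D j (e + d)) d = 0 :=
      (Nat.count_iff_forall_not).2 fun k _ hk => hk e (by omega) h
    rw [this]
    exact Nat.count_le _

/-- The least true requirement is the limit inferior of `leastActing`. -/
theorem leastActing_liminf {e : ℕ} (he : ∀ y, ∃ z, D e y z)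
    (hlt : ∀ j < e, ¬ ∀ y, ∃ z, D j y z) :
    (∃ v, ∀ s ≥ v, e ≤ leastActing D s) ∧ ∀ n, ∃ s ≥ n, leastActing D s = e := by
  have hev : ∃ v, ∀ s ≥ v, e ≤ leastActing D s := by
    have : ∀ j, ∃ v, j < e → ∀ s ≥ v, ¬ Acts D j s := by
      intro j
      by_cases hj : j < e
      · exact (eventually_not_acts (hlt j hj)).imp fun v hv _ => hv
      · exact ⟨0, fun h => absurd h hj⟩
    choose v hv using this
    refine ⟨max e ((Finset.range e).sup v), fun s hs => le_leastActing (by omega) fun j hj => ?_⟩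
    have : v j ≤ (Finset.range e).sup v := Finset.le_sup (Finset.mem_range.2 hj)
    exact hv j hj s (by omega)
  refine ⟨hev, fun n => ?_⟩
  obtain ⟨v, hv⟩ := hev
  obtain ⟨s, hs, hact⟩ := exists_acts he (max n v)
  exact ⟨s, by omega, le_antisymm (leastActing_le hact) (hv s (by omega))⟩

theorem primrec_leastActing {D : ℕ → ℕ → ℕ → ℕ → Prop}
    (hD : PrimrecPred fun q : ℕ × ℕ × ℕ × ℕ => D q.1 q.2.1 q.2.2.1 q.2.2.2) :
    Primrec₂ fun a s => leastActing (D a) s := by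
  classical
  have hver : PrimrecPred fun q : ℕ × ℕ × ℕ × ℕ => Verified (D q.1) q.2.1 q.2.2.1 q.2.2.2 := by
    have hy : Primrec fun q : ℕ × ℕ × ℕ × ℕ => q.2.2.1 :=
      Primrec.fst.comp (Primrec.snd.comp Primrec.snd)
    have hs : Primrec fun q : ℕ × ℕ × ℕ × ℕ => q.2.2.2 :=
      Primrec.snd.comp (Primrec.snd.comp Primrec.snd)
    refine (Primrec.nat_lt.comp hy hs).and (primrecPred_forall_lt (Primrec.succ.comp hy)
      (primrecPred_exists_lt (hs.comp Primrec.fst) (hD.comp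
        (f := fun r : ((ℕ × ℕ × ℕ × ℕ) × ℕ) × ℕ => (r.1.1.1, r.1.1.2.1, r.1.2, r.2)) ?_)))
    exact (Primrec.fst.comp (Primrec.fst.comp Primrec.fst)).pair
      ((Primrec.fst.comp (Primrec.snd.comp (Primrec.fst.comp Primrec.fst))).pair
        ((Primrec.snd.comp Primrec.fst).pair Primrec.snd))
  have hacts : PrimrecPred fun q : ℕ × ℕ × ℕ => Acts (D q.1) q.2.1 q.2.2 := by
    have hs : Primrec fun q : ℕ × ℕ × ℕ => q.2.2 := Primrec.snd.comp Primrec.snd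
    have ha : Primrec fun r : (ℕ × ℕ × ℕ) × ℕ => r.1.1 := Primrec.fst.comp Primrec.fst
    have hi : Primrec fun r : (ℕ × ℕ × ℕ) × ℕ => r.1.2.1 :=
      Primrec.fst.comp (Primrec.snd.comp Primrec.fst)
    have hs' : Primrec fun r : (ℕ × ℕ × ℕ) × ℕ => r.1.2.2 := hs.comp Primrec.fst
    refine primrecPred_exists_lt (Primrec.succ.comp hs) ((hver.comp (ha.pair (hi.pair
      (Primrec.snd.pair (Primrec.succ.comp hs'))))).and (hver.comp (ha.pair (hi.pair
      (Primrec.snd.pair hs')))).not)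
  refine primrec_count (R := fun (p : ℕ × ℕ) i => ∀ j < i + 1, ¬ Acts (D p.1) j p.2)
    Primrec.snd (primrecPred_forall_lt (Primrec.succ.comp Primrec.snd) ?_)
  exact (hacts.comp ((Primrec.fst.comp (Primrec.fst.comp Primrec.fst)).pair
    (Primrec.snd.pair (Primrec.snd.comp (Primrec.fst.comp Primrec.fst))))).not

end Requirements

/-! ### Indices -/

theorem rfind_some_dom (g : ℕ → Bool) :
    (Nat.rfind fun z => Part.some (g z)).Dom ↔ ∃ z, g z = true := by
  refine Nat.rfind_dom.trans (exists_congr fun z => ?_)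
  exact ⟨fun h => (Part.mem_some_iff.1 h.1).symm,
    fun h => ⟨Part.mem_some_iff.2 h.symm, fun _ => trivial⟩⟩

theorem exists_code_dom_iff {f : ℕ → ℕ → Bool} (hf : Computable₂ f) :
    ∃ c : Nat.Partrec.Code, ∀ v, (c.eval v).Dom ↔ ∃ z, f v z = true := by
  have h : Partrec fun v => Nat.rfind fun z => Part.some (f v z) := Partrec.rfind hf.partrec₂
  obtain ⟨c, hc⟩ := Nat.Partrec.Code.exists_code.1 (Partrec.nat_iff.1 h)
  refine ⟨c, fun v => ?_⟩
  rw [hc]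
  exact rfind_some_dom _

/-- The complement of a `Π⁰₃` set is `Σ⁰₃`, with the inner `Σ⁰₁` matrix given by a c.e. set. -/
theorem IsPi03.exists_not_mem_iff {A : Set ℕ} (hA : IsPi03 A) :
    ∃ k, ∀ n, n ∉ A ↔ ∃ x, ∀ y, Nat.pair n (Nat.pair x y) ∈ W k := by
  obtain ⟨R, hR, hRA⟩ := hA
  obtain ⟨g, hg, hgR⟩ := ComputablePred.computable_iff.1 hR
  have hRg : ∀ n x y z, R n x y z ↔ g (n, x, y, z) = true := fun n x y z =>
    iff_of_eq (congrFun hgR (n, x, y, z))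
  have hf : Computable₂ fun v z : ℕ =>
      !g (v.unpair.1, v.unpair.2.unpair.1, v.unpair.2.unpair.2, z) := by
    have hv : Computable fun p : ℕ × ℕ => p.1.unpair := Computable.unpair.comp Computable.fst
    have hv2 : Computable fun p : ℕ × ℕ => p.1.unpair.2.unpair :=
      Computable.unpair.comp (Computable.snd.comp hv)
    exact Primrec.not.to_comp.comp (hg.comp ((Computable.fst.comp hv).pair
      ((Computable.fst.comp hv2).pair ((Computable.snd.comp hv2).pair Computable.snd))))
  obtain ⟨c, hc⟩ := exists_code_dom_iff hf
  refine ⟨Encodable.encode c, fun n => ?_⟩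
  simp [W, hc, hRA, hRg]

/-- By the recursion theorem, the construction may be run with the code `c` of the indexing function
`n ↦ curry c n` of the constructed ceers as a parameter. -/
theorem exists_code_built {ι : ℕ → ℕ → ℕ} {τ : ℕ → ℕ → ℕ → ℕ} (hι : Primrec₂ ι)
    (hτ : Primrec fun p : ℕ × ℕ × ℕ => τ p.1 p.2.1 p.2.2) :
    ∃ c : Nat.Partrec.Code, ∀ n, ceer (Encodable.encode (c.curry n)) =
      built (ι (Nat.pair (Encodable.encode c) n)) τ := by
  let f : Nat.Partrec.Code → ℕ → ℕ → Bool := fun c v u =>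
    decide (label (ι (Nat.pair (Encodable.encode c) v.unpair.1)) τ u v.unpair.2.unpair.1 =
      label (ι (Nat.pair (Encodable.encode c) v.unpair.1)) τ u v.unpair.2.unpair.2)
  have hf : Primrec fun p : (Nat.Partrec.Code × ℕ) × ℕ => f p.1.1 p.1.2 p.2 := by
    have hv : Primrec fun p : (Nat.Partrec.Code × ℕ) × ℕ => p.1.2.unpair :=
      Primrec.unpair.comp (Primrec.snd.comp Primrec.fst)
    have hv2 : Primrec fun p : (Nat.Partrec.Code × ℕ) × ℕ => p.1.2.unpair.2.unpair :=
      Primrec.unpair.comp (Primrec.snd.comp hv)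
    have ha : Primrec fun p : (Nat.Partrec.Code × ℕ) × ℕ =>
        Nat.pair (Encodable.encode p.1.1) p.1.2.unpair.1 :=
      Primrec₂.natPair.comp (Primrec.encode.comp (Primrec.fst.comp Primrec.fst))
        (Primrec.fst.comp hv)
    exact (Primrec.eq.comp
      ((primrec_label hι hτ).comp (ha.pair (Primrec.snd.pair (Primrec.fst.comp hv2))))
      ((primrec_label hι hτ).comp (ha.pair (Primrec.snd.pair (Primrec.snd.comp hv2))))).decide
  have hrec : Partrec₂ fun (c : Nat.Partrec.Code) (v : ℕ) =>
      Nat.rfind fun u => Part.some (f c v u) :=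
    Partrec.rfind (Computable₂.partrec₂ (f := fun (p : Nat.Partrec.Code × ℕ) u => f p.1 p.2 u)
      hf.to_comp)
  obtain ⟨c, hc⟩ := Nat.Partrec.Code.fixed_point₂ hrec
  refine ⟨c, fun n => ?_⟩
  have hW : ∀ x y, Nat.pair x y ∈ W (Encodable.encode (c.curry n)) ↔
      built (ι (Nat.pair (Encodable.encode c) n)) τ x y := by
    intro x y
    simp only [W, Denumerable.ofNat_encode, Set.mem_ofPred_eq, Nat.Partrec.Code.eval_curry, hc,
      built_iff]
    refine (rfind_some_dom _).trans ?_
    simp [f]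
  refine Setoid.ext fun x y => ⟨fun h => ?_, fun h => Relation.EqvGen.rel _ _ ((hW x y).2 h)⟩
  induction h with
  | rel x y h => exact (hW x y).1 h
  | refl x => exact Setoid.refl' _ x
  | symm x y _ ih => exact Setoid.symm' _ ih
  | trans x y z _ _ ih1 ih2 => exact Setoid.trans' _ ih1 ih2

theorem encode_curry_injective (c : Nat.Partrec.Code) :
    Function.Injective fun n : ℕ => Encodable.encode (c.curry n) := fun _ _ h =>
  (Nat.Partrec.Code.curry_inj (Encodable.encode_injective h)).2

/-- The `y`-th instance of requirement `i` with parameter `a = ⟨c, n⟩` holds with witness `z`, a bound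
on computation steps. For `i = 2 x` the requirement says that `x` witnesses membership of `n` in the
`Σ⁰₃` set given by `W k`; for `i = 2 x + 1` it says that `x` witnesses membership of the index of
`curry c n` in the `Σ⁰₃` set given by `W l`. -/
def requirement (k l a i y z : ℕ) : Prop :=
  (Nat.Partrec.Code.evaln z
    (Denumerable.ofNat Nat.Partrec.Code (if i % 2 = 0 then k else l))
    (Nat.pair (if i % 2 = 0 then a.unpair.2 else Encodable.encode
      ((Denumerable.ofNat Nat.Partrec.Code a.unpair.1).curry a.unpair.2))
      (Nat.pair (i / 2) y))).isSome = true

theorem primrec_requirement (k l : ℕ) : PrimrecPred fun q : ℕ × ℕ × ℕ × ℕ =>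
    requirement k l q.1 q.2.1 q.2.2.1 q.2.2.2 := by
  have ha : Primrec fun q : ℕ × ℕ × ℕ × ℕ => q.1.unpair := Primrec.unpair.comp Primrec.fst
  have hi : Primrec fun q : ℕ × ℕ × ℕ × ℕ => q.2.1 := Primrec.fst.comp Primrec.snd
  have hy : Primrec fun q : ℕ × ℕ × ℕ × ℕ => q.2.2.1 :=
    Primrec.fst.comp (Primrec.snd.comp Primrec.snd)
  have hz : Primrec fun q : ℕ × ℕ × ℕ × ℕ => q.2.2.2 :=
    Primrec.snd.comp (Primrec.snd.comp Primrec.snd)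
  have heven : PrimrecPred fun q : ℕ × ℕ × ℕ × ℕ => q.2.1 % 2 = 0 :=
    Primrec.eq.comp (Primrec.nat_mod.comp hi (Primrec.const 2)) (Primrec.const 0)
  have hcode : Primrec fun q : ℕ × ℕ × ℕ × ℕ =>
      Denumerable.ofNat Nat.Partrec.Code (if q.2.1 % 2 = 0 then k else l) :=
    (Primrec.ofNat _).comp (Primrec.ite heven (Primrec.const k) (Primrec.const l))
  have hidx : Primrec fun q : ℕ × ℕ × ℕ × ℕ =>
      if q.2.1 % 2 = 0 then q.1.unpair.2 else Encodable.encode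
        ((Denumerable.ofNat Nat.Partrec.Code q.1.unpair.1).curry q.1.unpair.2) :=
    Primrec.ite heven (Primrec.snd.comp ha) (Primrec.encode.comp
      (Nat.Partrec.Code.primrec₂_curry.comp ((Primrec.ofNat _).comp (Primrec.fst.comp ha))
        (Primrec.snd.comp ha)))
  exact Primrec.eq.comp (Primrec.option_isSome.comp (Nat.Partrec.Code.primrec_evaln.comp
    ((hz.pair hcode).pair (Primrec₂.natPair.comp hidx
      (Primrec₂.natPair.comp (Primrec.nat_div.comp hi (Primrec.const 2)) hy)))))
    (Primrec.const true)

theorem forall_requirement_even (k l : ℕ) (c : Nat.Partrec.Code) (n x : ℕ) :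
    (∀ y, ∃ z, requirement k l (Nat.pair (Encodable.encode c) n) (2 * x) y z) ↔
      ∀ y, Nat.pair n (Nat.pair x y) ∈ W k := by
  simp [requirement, mem_W_iff]

theorem forall_requirement_odd (k l : ℕ) (c : Nat.Partrec.Code) (n x : ℕ) :
    (∀ y, ∃ z, requirement k l (Nat.pair (Encodable.encode c) n) (2 * x + 1) y z) ↔
      ∀ y, Nat.pair (Encodable.encode (c.curry n)) (Nat.pair x y) ∈ W l := by
  have h1 : (2 * x + 1) % 2 = 1 := by omega
  have h2 : (2 * x + 1) / 2 = x := by omega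
  simp [requirement, mem_W_iff, h1, h2]

/-- If `S` is closed, `Π⁰₃` and separates the infinite ceers `i ∈ S` and `j ∉ S`, then every `Π⁰₃`
set is one-one reducible to `S`. -/
theorem oneOneReducible_of_separating {S B : Set ℕ} (hclosed : S = indexClosure S)
    (hS : IsPi03 S) (hB : IsPi03 B) {i j : ℕ} (hi : InfinitelyManyClasses (ceer i))
    (hj : InfinitelyManyClasses (ceer j)) (hiS : i ∈ S) (hjS : j ∉ S) :
    OneOneReducible (fun n : ℕ => n ∈ B) (fun n : ℕ => n ∈ S) := by
  classical
  obtain ⟨k, hk⟩ := hB.exists_not_mem_iff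
  obtain ⟨l, hl⟩ := hS.exists_not_mem_iff
  -- Even requirements aim at a ceer outside `S`, odd requirements at a ceer in `S`.
  let target : ℕ → ℕ := fun e => if e % 2 = 0 then j else i
  have htarget : Primrec target :=
    Primrec.ite (Primrec.eq.comp (Primrec.nat_mod.comp Primrec.id (Primrec.const 2))
      (Primrec.const 0)) (Primrec.const j) (Primrec.const i)
  have hinf : ∀ e, InfinitelyManyClasses (ceer (target e)) := by
    intro e
    simp only [target]
    split_ifs
    · exact hj
    · exact hi
  let τ : ℕ → ℕ → ℕ → ℕ := fun e => ceerApprox (target e)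
  have hτ : Primrec fun p : ℕ × ℕ × ℕ => τ p.1 p.2.1 p.2.2 :=
    primrec_ceerApprox.comp ((htarget.comp Primrec.fst).pair Primrec.snd)
  let ι : ℕ → ℕ → ℕ := fun a s => leastActing (requirement k l a) s
  have hι : Primrec₂ ι := primrec_leastActing (primrec_requirement k l)
  obtain ⟨c, hc⟩ := exists_code_built hι hτ
  refine ⟨fun n => Encodable.encode (c.curry n), (Primrec.encode.comp
    (Nat.Partrec.Code.primrec₂_curry.comp (Primrec.const c) Primrec.id)).to_comp,
    encode_curry_injective c, fun n => ?_⟩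
  change n ∈ B ↔ Encodable.encode (c.curry n) ∈ S
  have heven := forall_requirement_even k l c n
  have hodd := forall_requirement_odd k l c n
  have hbuilt := hc n
  generalize Nat.pair (Encodable.encode c) n = a at heven hodd hbuilt
  by_cases hex : ∃ e, ∀ y, ∃ z, requirement k l a e y z
  · have hspec := Nat.find_spec hex
    have hmin : ∀ e' < Nat.find hex, ¬ ∀ y, ∃ z, requirement k l a e' y z :=
      fun e' he' => Nat.find_min hex he'
    generalize Nat.find hex = e at hspec hmin
    obtain ⟨hprio, hio⟩ := leastActing_liminf hspec hmin
    have hequiv : CompEquiv (ceer (Encodable.encode (c.curry n))) (ceer (target e)) := by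
      rw [hbuilt]
      refine built_compEquiv (e := e) (hι.to_comp.comp (Computable.const a) Computable.id) ?_
        (ceerApprox_approximates (target e)) (hinf e) hprio hio
      exact ((primrec_label hι hτ).comp ((Primrec.const a).pair Primrec.id)).to_comp
    rcases Nat.even_or_odd' e with ⟨x, rfl | rfl⟩
    · have hnB : n ∉ B := (hk n).2 ⟨x, (heven x).1 hspec⟩
      have ht : target (2 * x) = j := if_pos (by omega)
      rw [ht] at hequiv
      refine iff_of_false hnB fun hmem => hjS ?_
      rw [hclosed]
      exact ⟨_, hmem, hequiv.2, hequiv.1⟩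
    · -- The requirement claims that the index is not in `S` and puts it into `S`.
      have hnS : Encodable.encode (c.curry n) ∉ S := (hl _).2 ⟨x, (hodd x).1 hspec⟩
      have ht : target (2 * x + 1) = i := if_neg (by omega)
      rw [ht] at hequiv
      refine absurd ?_ hnS
      rw [hclosed]
      exact ⟨i, hiS, hequiv⟩
  · refine iff_of_true ?_ ?_
    · by_contra hn
      obtain ⟨x, hx⟩ := (hk n).1 hn
      exact hex ⟨2 * x, (heven x).2 hx⟩
    · by_contra hn
      obtain ⟨x, hx⟩ := (hl _).1 hn
      exact hex ⟨2 * x + 1, (hodd x).2 hx⟩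

end CeerIndex

theorem mainTheorem4 (S : Set ℕ) (hclosed : S = CeerIndex.indexClosure S)
    (hPi : CeerIndex.IsPi03 S) (hproper : CeerIndex.ProperOnInfinite S) :
    CeerIndex.IsPi03Complete (CeerIndex.indexClosure S) := by
  obtain ⟨i, j, hi, hj, hiS, hjS⟩ := hproper
  rw [← hclosed] at hiS hjS ⊢
  exact ⟨hPi, fun _ hB =>
    CeerIndex.oneOneReducible_of_separating hclosed hPi hB hi hj hiS hjS⟩
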